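/- Let $\mu$ be a probability distribution on $\mathbb{R}^d$ with finite second moments, $n\ge 1$ an integer, $T>0$ and $\alpha>0$. Set $$t_k=\frac{\alpha^k-1}{\alpha^n-1}\,T\quad(0\le k\le n),$$ read as $t_k=kT/n$ (the limit $\alpha\to1$) when $\alpha=1$, and $\delta_k=t_k-t_{k-1}$ for $1\le k\le n$. Let $X\sim\mu$ be independent of a sequence $N_1,N_2,\dots$ of independent standard Gaussian vectors in $\mathbb{R}^d$, and let $$Y_0=0,\qquad Y_k=Y_{k-1}+\delta_kX+\sqrt{\delta_k}\,N_k .$$ For $k=1,\dots,n$ let $f_k\colon\mathbb{R}^d\to\mathbb{R}^d$ be the conditional mean estimator of $X$ given $Y_{k-1}$, i.e. a measurable function with $f_k(Y_{k-1})=\mathbb{E}[X\mid Y_{k-1}]$ almost surely, and let $$Z_0=0,\qquad Z_k=Z_{k-1}+\delta_kf_k(Z_{k-1})+\sqrt{\delta_k}\,\tilde N_k,$$ where $\tilde N_1,\tilde N_2,\dots$ are independent standard Gaussian vectors. Let $$\Delta_n=D\big(\mathsf{Law}(Y_1,\dots,Y_n)\,\|\,\mathsf{Law}(Z_1,\dots,Z_n)\big)$$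 be the Kullback–Leibler divergence (natural logarithm). For $s\ge0$ and $N\sim\mathsf{N}(0,\mathrm{I})$ independent of $X$, let $$M(s)=\mathbb{E}\big\|X-\mathbb{E}[X\mid\sqrt{s}\,X+N]\big\|^2,\qquad I(s)=I(X;\sqrt{s}\,X+N)=D\big(\mathsf{Law}(X,\sqrt sX+N)\,\|\,\mathsf{Law}(X)\otimes\mathsf{Law}(\sqrt sX+N)\big).$$ Then $I(T)$ and $\Delta_n$ are finite. If $\alpha\neq1$, then $$\Delta_n\le(\alpha-1)\left(\frac{T\,(M(0)-M(T))}{2(\alpha^n-1)}+I(T)-\frac{T\,M(T)}{2}\right),$$ and if $\alpha=1$, then (the limit of this bound as $\alpha\to1$) $$\Delta_n\le\frac{T\,(M(0)-M(T))}{2n}.$$ -/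

import Mathlib

open MeasureTheory ProbabilityTheory InformationTheory
open scoped ENNReal

noncomputable section

namespace GaussSampling

/-- Geometric time steps `t_k = (α^k - 1) / (α^n - 1) * T` with rate `α`; the rate `α = 1`, where
this quotient is `0 / 0`, stands for the uniform times `t_k = k * T / n` (its limit). -/
def geomTime (α T : ℝ) (n k : ℕ) : ℝ :=
  if α = 1 then (k : ℝ) / (n : ℝ) * T else (α ^ k - 1) / (α ^ n - 1) * T

/-- Step sizes `δ_k = t_k - t_{k-1}` for `k ≥ 1`, where `t_0 = 0`. The value at `k = 0` is never
used. -/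
def geomStep (α T : ℝ) (n k : ℕ) : ℝ :=
  geomTime α T n k - geomTime α T n (k - 1)

section Processes

variable {E Ω : Type*} [NormedAddCommGroup E] [NormedSpace ℝ E]

/-- Comparison process: `Y_0 = 0`, `Y_k = Y_{k-1} + δ_k X + √δ_k N_k`. -/
def compProcess (δ : ℕ → ℝ) (X : Ω → E) (N : ℕ → Ω → E) : ℕ → Ω → E
  | 0 => fun _ => 0
  | k + 1 => fun ω =>
      compProcess δ X N k ω + δ (k + 1) • X ω + Real.sqrt (δ (k + 1)) • N (k + 1) ω

/-- Sampling process: `Z_0 = 0`, `Z_k = Z_{k-1} + δ_k f_k(Z_{k-1}) + √δ_k N_k`. -/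
def samplingProcess (δ : ℕ → ℝ) (f : ℕ → E → E) (N : ℕ → Ω → E) : ℕ → Ω → E
  | 0 => fun _ => 0
  | k + 1 => fun ω =>
      samplingProcess δ f N k ω + δ (k + 1) • f (k + 1) (samplingProcess δ f N k ω)
        + Real.sqrt (δ (k + 1)) • N (k + 1) ω

/-- The joint law of `(V_1, …, V_n)`. -/
def pathLaw [MeasurableSpace E] [MeasurableSpace Ω] (P : Measure Ω) (V : ℕ → Ω → E) (n : ℕ) :
    Measure (Fin n → E) :=
  P.map (fun ω (i : Fin n) => V (i.val + 1) ω)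

end Processes

/-- `g` is a version of the conditional mean estimator of `X` given `Y`: a measurable function with
`g(Y) = 𝔼[X | Y]` almost surely. -/
def IsCondMeanEstimator {E F Ω : Type*} [NormedAddCommGroup E] [NormedSpace ℝ E] [CompleteSpace E]
    [MeasurableSpace E] [MeasurableSpace F] [MeasurableSpace Ω] (P : Measure Ω) (X : Ω → E)
    (Y : Ω → F) (g : F → E) : Prop :=
  Measurable g ∧ (fun ω => g (Y ω)) =ᵐ[P] P[X | MeasurableSpace.comap Y inferInstance]

/-- Mutual information `I(X; Y) = D(Law(X, Y) ‖ Law(X) ⊗ Law(Y))`, in nats. -/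
def mutualInfo {E F Ω : Type*} [MeasurableSpace E] [MeasurableSpace F] [MeasurableSpace Ω]
    (P : Measure Ω) (X : Ω → E) (Y : Ω → F) : ℝ≥0∞ :=
  klDiv (P.map (fun ω => (X ω, Y ω))) ((P.map X).prod (P.map Y))

/-- The joint law `μ ⊗ N(0, I)` of an independent pair `(X, N)`. -/
def pairLaw {d : ℕ} (μ : Measure (EuclideanSpace ℝ (Fin d))) :
    Measure (EuclideanSpace ℝ (Fin d) × EuclideanSpace ℝ (Fin d)) :=
  μ.prod (stdGaussian (EuclideanSpace ℝ (Fin d)))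

/-- The observation `√s X + N` as a function of the pair `(X, N)`. -/
def channel {d : ℕ} (s : ℝ) (p : EuclideanSpace ℝ (Fin d) × EuclideanSpace ℝ (Fin d)) :
    EuclideanSpace ℝ (Fin d) :=
  Real.sqrt s • p.1 + p.2

/-- The MMSE function `M(s) = 𝔼 ‖X - 𝔼[X | √s X + N]‖²`, where `X ∼ μ` and `N ∼ N(0, I)` are
independent. -/
def mmse {d : ℕ} (μ : Measure (EuclideanSpace ℝ (Fin d))) (s : ℝ) : ℝ :=
  ∫ p, ‖p.1 - ((pairLaw μ)[Prod.fst | MeasurableSpace.comap (channel s) inferInstance]) p‖ ^ 2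
    ∂(pairLaw μ)

/-- `I(s) = I(X; √s X + N)`, where `X ∼ μ` and `N ∼ N(0, I)` are independent. -/
def channelInfo {d : ℕ} (μ : Measure (EuclideanSpace ℝ (Fin d))) (s : ℝ) : ℝ≥0∞ :=
  mutualInfo (pairLaw μ) Prod.fst (channel s)

end GaussSampling

end

/-!
# Divergence of the Gaussian sampling process

Write `t_k` for the elapsed times, `S` for the second moment of `μ`, and

* `relEnt μ t` for the divergence of the law of `t X + √t N` from that of `√t N`,
* `estEnergy μ t` for the second moment of `𝔼[X | t X + √t N]`.

**Exact formulas.** Given `X = x`, the comparison process is a Gaussian walk of constant drift, so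
Girsanov's formula in discrete time (iterated Cameron–Martin) gives densities for both path laws
with respect to the driftless walk: `evidence μ T (y_n)`, a function of the endpoint alone, for the
comparison process, and `pathLik` for the sampling process. The divergence is the mean of the log
ratio along the comparison process. As `f_k (Y_{k-1})` is the conditional mean of `X`, it is
uncorrelated with the next noise vector and correlates with `X` exactly as with itself, whence
`Δ = relEnt μ T - ½ ∑ δ_k estEnergy μ t_{k-1}` (`IsSignalNoise.klDiv_pathLaw`). Similarly
`I(T) = T S / 2 - relEnt μ T` (`channelInfo_eq`) and `M(t) = S - estEnergy μ t` (`mmse_eq`).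

**The inequality.** The steps satisfy `δ_{k+1} = α δ_k`, so the left Riemann sum of the energy is
`α` times the right one up to boundary terms (`sum_left_eq`), and the claim reduces to
`relEnt μ T ≤ ½ ∑ δ_k estEnergy μ t_k`. This follows from
`relEnt μ b - relEnt μ a ≤ (b - a) / 2 * estEnergy μ b` (`relEnt_sub_le`), one half of the I-MMSE
relation, which is proved without differentiating. For a signal of bounded support a step of length
`h` increases the relative entropy by at most `h / 2 * estEnergy μ a + O(h²)`: one compares with the
Gaussian that has the conditional mean as its drift, and bounds the divergence from it by the `χ²`
divergence, in which the term of first order vanishes (`relEnt_sub_relEnt_zero_le`). The energy is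
monotone, so subdividing `[a, b]` removes the error term. The general case follows by restricting
`μ` to balls; the quantities make sense for unnormalized measures, and dominated convergence
applies to both sides.
-/

set_option linter.unusedSectionVars false

namespace GaussSampling

/-! ### Gaussian measures: exponential moments, Cameron–Martin, sums -/

section Gaussian

variable {E : Type*} [NormedAddCommGroup E] [InnerProductSpace ℝ E] [FiniteDimensional ℝ E]
  [MeasurableSpace E] [BorelSpace E]

lemma map_inner_stdGaussian (x : E) :
    (stdGaussian E).map (fun v => inner ℝ x v) = gaussianReal 0 (‖x‖ ^ 2).toNNReal := by
  have h := IsGaussian.map_eq_gaussianReal (μ := stdGaussian E) (innerSL ℝ x)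
  rw [variance_dual_stdGaussian, integral_strongDual_stdGaussian, innerSL_apply_norm] at h
  exact h

lemma integrable_exp_inner_stdGaussian (x : E) :
    Integrable (fun v => Real.exp (inner ℝ x v)) (stdGaussian E) := by
  have h := integrable_exp_mul_gaussianReal (μ := 0) (v := (‖x‖ ^ 2).toNNReal) 1
  rw [← map_inner_stdGaussian, integrable_map_measure (by fun_prop) (by fun_prop)] at h
  simpa [Function.comp_def] using h

lemma integral_exp_inner_stdGaussian (x : E) :
    ∫ v, Real.exp (inner ℝ x v) ∂(stdGaussian E) = Real.exp (‖x‖ ^ 2 / 2) := by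
  have h := mgf_gaussianReal (p := stdGaussian E) (X := fun v => inner ℝ x v)
    (map_inner_stdGaussian x) 1
  simpa [mgf] using h

lemma integrable_exp_mul_norm_stdGaussian (c : ℝ) :
    Integrable (fun v => Real.exp (c * ‖v‖)) (stdGaussian E) := by
  obtain ⟨C, hC, h⟩ := IsGaussian.exists_integrable_exp_sq (stdGaussian E)
  refine (h.const_mul (Real.exp (c ^ 2 / (4 * C)))).mono' (by fun_prop) ?_
  refine Filter.Eventually.of_forall fun v => ?_
  rw [Real.norm_eq_abs, Real.abs_exp, ← Real.exp_add, Real.exp_le_exp]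
  have : c ^ 2 / (4 * C) + C * ‖v‖ ^ 2 - c * ‖v‖ = (c - 2 * C * ‖v‖) ^ 2 / (4 * C) := by
    field_simp; ring
  have : 0 ≤ (c - 2 * C * ‖v‖) ^ 2 / (4 * C) := by positivity
  linarith

lemma lintegral_exp_inner_stdGaussian (x : E) :
    ∫⁻ v, ENNReal.ofReal (Real.exp (inner ℝ x v - ‖x‖ ^ 2 / 2)) ∂(stdGaussian E) = 1 := by
  simp_rw [Real.exp_sub]
  rw [← ofReal_integral_eq_lintegral_ofReal ((integrable_exp_inner_stdGaussian x).div_const _)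
    (Filter.Eventually.of_forall fun v => by positivity), integral_div,
    integral_exp_inner_stdGaussian, div_self (Real.exp_pos _).ne', ENNReal.ofReal_one]

/-- Real measures with the same moment generating function, finite everywhere, agree. -/
lemma measure_ext_of_mgf {ν ρ : Measure ℝ} [IsProbabilityMeasure ν] [IsProbabilityMeasure ρ]
    (hν : ∀ t : ℝ, Integrable (fun x => Real.exp (t * x)) ν)
    (h : ∀ t, ∫ x, Real.exp (t * x) ∂ν = ∫ x, Real.exp (t * x) ∂ρ) : ν = ρ := by
  refine Measure.ext_of_complexMGF_id_eq ?_
  have h2 : mgf id ν = mgf id ρ := by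
    ext t; exact h t
  have h3 := eqOn_complexMGF_of_mgf h2
  ext z
  apply h3
  have : integrableExpSet id ν = Set.univ := by
    ext t; simpa [integrableExpSet] using hν t
  simp [this]

/-- The **Cameron–Martin formula**: translating the standard Gaussian by `x` multiplies it by the
density `exp (⟪x, ·⟫ - ‖x‖² / 2)`. -/
theorem map_add_stdGaussian (x : E) :
    (stdGaussian E).map (fun v => x + v) = (stdGaussian E).withDensity
      (fun v => ENNReal.ofReal (Real.exp (inner ℝ x v - ‖x‖ ^ 2 / 2))) := by
  have hm : Measurable fun v : E =>
      ENNReal.ofReal (Real.exp (inner ℝ x v - ‖x‖ ^ 2 / 2)) := by fun_prop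
  have : IsProbabilityMeasure ((stdGaussian E).map (fun v => x + v)) :=
    Measure.isProbabilityMeasure_map (by fun_prop)
  have : IsProbabilityMeasure ((stdGaussian E).withDensity
      (fun v => ENNReal.ofReal (Real.exp (inner ℝ x v - ‖x‖ ^ 2 / 2)))) :=
    ⟨by simpa using lintegral_exp_inner_stdGaussian x⟩
  -- It suffices to compare the laws of `⟪t, ·⟫`, whose moment generating functions are explicit.
  refine Measure.ext_of_charFun ?_
  ext t
  have key : ((stdGaussian E).map (fun v => x + v)).map (fun v => inner ℝ v t) =
      ((stdGaussian E).withDensity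
      (fun v => ENNReal.ofReal (Real.exp (inner ℝ x v - ‖x‖ ^ 2 / 2)))).map
        (fun v => inner ℝ v t) := by
    have := Measure.isProbabilityMeasure_map
      (μ := (stdGaussian E).map (fun v => x + v)) (f := fun v => inner ℝ v t) (by fun_prop)
    have := Measure.isProbabilityMeasure_map
      (μ := (stdGaussian E).withDensity
      (fun v => ENNReal.ofReal (Real.exp (inner ℝ x v - ‖x‖ ^ 2 / 2))))
      (f := fun v => inner ℝ v t) (by fun_prop)
    refine measure_ext_of_mgf (fun s => ?_) (fun s => ?_)
    · rw [Measure.map_map (by fun_prop) (by fun_prop),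
        integrable_map_measure (by fun_prop) (by fun_prop)]
      refine ((integrable_exp_inner_stdGaussian (s • t)).const_mul
        (Real.exp (s * inner ℝ x t))).congr (Filter.Eventually.of_forall fun v => ?_)
      simp only [Function.comp_def, inner_add_left, ← Real.exp_add, inner_smul_left,
        real_inner_comm v t]
      congr 1
      simp; ring
    · rw [Measure.map_map (by fun_prop) (by fun_prop), integral_map (by fun_prop) (by fun_prop),
        integral_map (by fun_prop) (by fun_prop),
        integral_withDensity_eq_integral_toReal_smul hm (by simp)]
      simp only [Function.comp_def]
      have e1 : ∀ v : E, Real.exp (s * inner ℝ (x + v) t) =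
          Real.exp (s * inner ℝ x t) * Real.exp (inner ℝ (s • t) v) := fun v => by
        rw [← Real.exp_add, inner_add_left, inner_smul_left, real_inner_comm v t]
        congr 1
        simp; ring
      have e2 : ∀ v : E, (ENNReal.ofReal (Real.exp (inner ℝ x v - ‖x‖ ^ 2 / 2))).toReal •
          Real.exp (s * inner ℝ v t) =
          Real.exp (-(‖x‖ ^ 2 / 2)) * Real.exp (inner ℝ (x + s • t) v) := fun v => by
        rw [ENNReal.toReal_ofReal (Real.exp_pos _).le, smul_eq_mul, ← Real.exp_add,
          ← Real.exp_add, inner_add_left, inner_smul_left, real_inner_comm v t]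
        congr 1
        simp; ring
      simp_rw [e1, e2, integral_const_mul, integral_exp_inner_stdGaussian, ← Real.exp_add]
      congr 1
      rw [norm_add_sq_real, norm_smul, inner_smul_right, mul_pow, Real.norm_eq_abs, sq_abs]
      ring
  have h1 := fun (ρ : Measure E) => integral_map (μ := ρ) (φ := fun v => inner ℝ v t)
    (f := fun y : ℝ => Complex.exp (y * Complex.I)) (by fun_prop) (by fun_prop)
  rw [charFun_apply, charFun_apply, ← h1, ← h1, key]

lemma lintegral_add_stdGaussian {F : E → ℝ≥0∞} (hF : Measurable F) (x : E) :
    ∫⁻ v, F (x + v) ∂(stdGaussian E) =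
      ∫⁻ v, ENNReal.ofReal (Real.exp (inner ℝ x v - ‖x‖ ^ 2 / 2)) * F v ∂(stdGaussian E) := by
  rw [← lintegral_map hF (by fun_prop : Measurable fun v => x + v), map_add_stdGaussian,
    lintegral_withDensity_eq_lintegral_mul _ (by fun_prop) hF]
  rfl

/-- The increments of a Brownian path: `√a v + √h v'` has the law of `√(a + h) v`. -/
lemma map_add_smul_stdGaussian {a h : ℝ} (ha : 0 ≤ a) (hh : 0 ≤ h) :
    ((stdGaussian E).prod (stdGaussian E)).map
        (fun p => Real.sqrt a • p.1 + Real.sqrt h • p.2) =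
      (stdGaussian E).map (fun v => Real.sqrt (a + h) • v) := by
  have : IsProbabilityMeasure ((stdGaussian E).map (fun v => Real.sqrt (a + h) • v)) :=
    Measure.isProbabilityMeasure_map (by fun_prop)
  have : IsProbabilityMeasure (((stdGaussian E).prod (stdGaussian E)).map
        (fun p => Real.sqrt a • p.1 + Real.sqrt h • p.2)) :=
    Measure.isProbabilityMeasure_map (by fun_prop)
  refine Measure.ext_of_charFun ?_
  ext t
  rw [charFun_apply, charFun_apply, integral_map (by fun_prop) (by fun_prop),
    integral_map (by fun_prop) (by fun_prop)]
  have e1 : ∀ (c : ℝ) (v : E), inner ℝ (c • v) t = inner ℝ v (c • t) := fun c v => by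
    rw [inner_smul_left, inner_smul_right]; simp
  simp_rw [inner_add_left, e1, Complex.ofReal_add, add_mul, Complex.exp_add]
  rw [integral_prod_mul (fun v => Complex.exp ((inner ℝ v (Real.sqrt a • t) : ℝ) * Complex.I))
    (fun v => Complex.exp ((inner ℝ v (Real.sqrt h • t) : ℝ) * Complex.I)),
    ← charFun_apply, ← charFun_apply, ← charFun_apply, charFun_stdGaussian, charFun_stdGaussian,
    charFun_stdGaussian, ← Complex.exp_add]
  congr 1
  simp only [norm_smul, mul_pow, Real.norm_eq_abs, sq_abs, Complex.ofReal_mul,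
    ← Complex.ofReal_pow, Real.sq_sqrt ha, Real.sq_sqrt hh, Real.sq_sqrt (add_nonneg ha hh)]
  push_cast
  ring

end Gaussian

/-! ### Likelihoods and their averages over signal and noise -/

section Tilt

variable {E : Type*} [NormedAddCommGroup E] [InnerProductSpace ℝ E]

/-- The likelihood of the observation `y` at time `t` when the signal is `x`: the density of
`t x + √t N` with respect to the law of `√t N`. -/
noncomputable def tilt (t : ℝ) (x y : E) : ℝ := Real.exp (inner ℝ x y - t / 2 * ‖x‖ ^ 2)

/-- The marginal likelihood of the observation `y` at time `t` when the signal has law `μ`. -/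
noncomputable def evidence [MeasurableSpace E] (μ : Measure E) (t : ℝ) (y : E) : ℝ :=
  ∫ x, tilt t x y ∂μ

/-- The unnormalized posterior mean of the signal given the observation `y` at time `t`: the
posterior mean is the quotient by `evidence μ t y`. -/
noncomputable def tiltMean [MeasurableSpace E] (μ : Measure E) (t : ℝ) (y : E) : E :=
  ∫ x, tilt t x y • x ∂μ

lemma tilt_pos (t : ℝ) (x y : E) : 0 < tilt t x y := Real.exp_pos _

@[simp] lemma tilt_zero_zero (x : E) : tilt 0 x 0 = 1 := by simp [tilt]

lemma tilt_add (s t : ℝ) (x y z : E) : tilt (s + t) x (y + z) = tilt s x y * tilt t x z := by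
  rw [tilt, tilt, tilt, ← Real.exp_add, inner_add_right]
  congr 1; ring

@[fun_prop]
lemma continuous_tilt (t : ℝ) : Continuous fun p : E × E => tilt t p.1 p.2 := by
  unfold tilt; fun_prop

lemma tilt_le_exp_mul_norm {t : ℝ} (ht : 0 ≤ t) {x : E} {R : ℝ} (hx : ‖x‖ ≤ R) (y : E) :
    tilt t x y ≤ Real.exp (R * ‖y‖) := by
  rw [tilt, Real.exp_le_exp]
  have h1 := real_inner_le_norm x y
  have h2 : ‖x‖ * ‖y‖ ≤ R * ‖y‖ := by gcongr
  have : 0 ≤ t / 2 * ‖x‖ ^ 2 := by positivity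
  linarith

/-- At positive times the likelihood is a bounded function of the signal. -/
lemma tilt_le_of_pos {t : ℝ} (ht : 0 < t) (x y : E) :
    tilt t x y ≤ Real.exp (‖y‖ ^ 2 / (2 * t)) := by
  rw [tilt, Real.exp_le_exp]
  have h1 := real_inner_le_norm x y
  have : ‖y‖ ^ 2 / (2 * t) + t / 2 * ‖x‖ ^ 2 - ‖x‖ * ‖y‖ = (‖y‖ - t * ‖x‖) ^ 2 / (2 * t) := by
    field_simp; ring
  have : 0 ≤ (‖y‖ - t * ‖x‖) ^ 2 / (2 * t) := by positivity
  linarith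

lemma tilt_smul_eq (t : ℝ) (ht : 0 ≤ t) (x v : E) : tilt t x (Real.sqrt t • v) =
    Real.exp (inner ℝ (Real.sqrt t • x) v - ‖Real.sqrt t • x‖ ^ 2 / 2) := by
  rw [tilt, inner_smul_right, inner_smul_left, norm_smul, mul_pow, Real.norm_eq_abs, sq_abs,
    Real.sq_sqrt ht]
  congr 1; simp; ring

variable [MeasurableSpace E]

lemma evidence_nonneg (μ : Measure E) (t : ℝ) (y : E) : 0 ≤ evidence μ t y :=
  integral_nonneg fun x => (tilt_pos t x y).le

lemma evidence_pos {μ : Measure E} [NeZero μ] {t : ℝ} {y : E}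
    (h : Integrable (fun x => tilt t x y) μ) : 0 < evidence μ t y := by
  rw [evidence, integral_pos_iff_support_of_nonneg (fun x => (tilt_pos t x y).le) h]
  have : Function.support (fun x => tilt t x y) = Set.univ := by
    ext x; simpa using (tilt_pos t x y).ne'
  rw [this]
  exact Measure.measure_univ_pos.2 (NeZero.ne μ)

lemma evidence_zero (μ : Measure E) : evidence μ 0 0 = μ.real Set.univ := by simp [evidence]

variable [BorelSpace E] [FiniteDimensional ℝ E]

lemma stronglyMeasurable_evidence (μ : Measure E) [SFinite μ] (t : ℝ) :
    StronglyMeasurable (evidence μ t) := by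
  have h : StronglyMeasurable fun p : E × E => tilt t p.2 p.1 :=
    ((continuous_tilt t).comp continuous_swap).stronglyMeasurable
  exact h.integral_prod_right

lemma stronglyMeasurable_tiltMean (μ : Measure E) [SFinite μ] (t : ℝ) :
    StronglyMeasurable (tiltMean μ t) := by
  have h : StronglyMeasurable fun p : E × E => tilt t p.2 p.1 • p.2 :=
    (((continuous_tilt t).comp continuous_swap).smul continuous_snd).stronglyMeasurable
  exact h.integral_prod_right

@[fun_prop]
lemma measurable_evidence (μ : Measure E) [SFinite μ] (t : ℝ) : Measurable (evidence μ t) :=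
  (stronglyMeasurable_evidence μ t).measurable

@[fun_prop]
lemma measurable_tiltMean (μ : Measure E) [SFinite μ] (t : ℝ) : Measurable (tiltMean μ t) :=
  (stronglyMeasurable_tiltMean μ t).measurable

lemma lintegral_tilt_stdGaussian {t : ℝ} (ht : 0 ≤ t) (x : E) :
    ∫⁻ v, ENNReal.ofReal (tilt t x (Real.sqrt t • v)) ∂(stdGaussian E) = 1 := by
  simp_rw [tilt_smul_eq t ht]
  exact lintegral_exp_inner_stdGaussian _

lemma integrable_tilt_stdGaussian {t : ℝ} (ht : 0 ≤ t) (x : E) :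
    Integrable (fun v => tilt t x (Real.sqrt t • v)) (stdGaussian E) := by
  simp_rw [tilt_smul_eq t ht, Real.exp_sub]
  exact (integrable_exp_inner_stdGaussian _).div_const _

lemma integral_tilt_stdGaussian {t : ℝ} (ht : 0 ≤ t) (x : E) :
    ∫ v, tilt t x (Real.sqrt t • v) ∂(stdGaussian E) = 1 := by
  rw [integral_eq_lintegral_of_nonneg_ae (Filter.Eventually.of_forall fun v => (tilt_pos _ _ _).le)
    (integrable_tilt_stdGaussian ht x).1, lintegral_tilt_stdGaussian ht, ENNReal.toReal_one]

lemma integral_tilt_mul_inner_stdGaussian {t : ℝ} (ht : 0 ≤ t) (x m : E) :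
    ∫ v, tilt t x (Real.sqrt t • v) * inner ℝ m v ∂(stdGaussian E) =
      Real.sqrt t * inner ℝ m x := by
  have hm : Measurable fun v : E => ENNReal.ofReal (Real.exp
      (inner ℝ (Real.sqrt t • x) v - ‖Real.sqrt t • x‖ ^ 2 / 2)) := by fun_prop
  have h1 : ∫ v, inner ℝ m v ∂((stdGaussian E).map (fun v => Real.sqrt t • x + v)) =
      ∫ v, tilt t x (Real.sqrt t • v) * inner ℝ m v ∂(stdGaussian E) := by
    rw [map_add_stdGaussian, integral_withDensity_eq_integral_toReal_smul hm (by simp)]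
    refine integral_congr_ae (Filter.Eventually.of_forall fun v => ?_)
    simp only [smul_eq_mul, ENNReal.toReal_ofReal (Real.exp_pos _).le]
    rw [tilt_smul_eq t ht]
  rw [← h1, integral_map (by fun_prop) (by fun_prop)]
  have h2 : ∫ v, inner ℝ m v ∂(stdGaussian E) = 0 :=
    integral_strongDual_stdGaussian (innerSL ℝ m)
  have h3 : Integrable (fun v : E => (inner ℝ m v : ℝ)) (stdGaussian E) :=
    IsGaussian.integrable_dual (stdGaussian E) (innerSL ℝ m)
  simp_rw [inner_add_right, inner_smul_right]
  rw [integral_add (integrable_const _) h3, h2]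
  simp

end Tilt

section Fubini

variable {E : Type*} [NormedAddCommGroup E] [InnerProductSpace ℝ E] [FiniteDimensional ℝ E]
  [MeasurableSpace E] [BorelSpace E] {μ : Measure E} [SFinite μ]

lemma integrable_tilt_smul_prod {F : Type*} [NormedAddCommGroup F] [NormedSpace ℝ F] {g : E → F}
    (hg : Integrable g μ) {t : ℝ} (ht : 0 ≤ t) :
    Integrable (fun p : E × E => tilt t p.2 (Real.sqrt t • p.1) • g p.2)
      ((stdGaussian E).prod μ) := by
  have hm : AEStronglyMeasurable (fun p : E × E => tilt t p.2 (Real.sqrt t • p.1) • g p.2)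
      ((stdGaussian E).prod μ) :=
    (by unfold tilt; fun_prop : AEStronglyMeasurable
      (fun p : E × E => tilt t p.2 (Real.sqrt t • p.1)) _).smul hg.1.comp_snd
  rw [integrable_prod_iff' hm]
  refine ⟨Filter.Eventually.of_forall fun x =>
    (integrable_tilt_stdGaussian ht x).smul_const (g x), ?_⟩
  simp_rw [norm_smul, integral_mul_const, Real.norm_of_nonneg (tilt_pos _ _ _).le,
    integral_tilt_stdGaussian ht, one_mul]
  exact hg.norm

/-- Averaging over the noise at time `t` a likelihood-weighted integral over the signal gives back
the prior integral. -/
lemma integral_integral_tilt_smul {F : Type*} [NormedAddCommGroup F] [NormedSpace ℝ F]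
    [CompleteSpace F] {g : E → F} (hg : Integrable g μ) {t : ℝ} (ht : 0 ≤ t) :
    ∫ v, ∫ x, tilt t x (Real.sqrt t • v) • g x ∂μ ∂(stdGaussian E) = ∫ x, g x ∂μ := by
  rw [integral_integral_swap (f := fun v x => tilt t x (Real.sqrt t • v) • g x)
    (integrable_tilt_smul_prod hg ht)]
  simp_rw [integral_smul_const, integral_tilt_stdGaussian ht, one_smul]

lemma ae_integrable_tilt_smul {F : Type*} [NormedAddCommGroup F] [NormedSpace ℝ F] {g : E → F}
    (hg : Integrable g μ) {t : ℝ} (ht : 0 ≤ t) :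
    ∀ᵐ v ∂(stdGaussian E), Integrable (fun x => tilt t x (Real.sqrt t • v) • g x) μ :=
  (integrable_tilt_smul_prod hg ht).prod_right_ae

/-- The squared norm of the unnormalized posterior mean, divided by the evidence, is at most the
unnormalized posterior second moment (Cauchy–Schwarz). -/
lemma norm_tiltMean_sq_div_le {t : ℝ} {y : E} (h0 : Integrable (fun x => tilt t x y) μ)
    (h1 : Integrable (fun x => tilt t x y • x) μ)
    (h2 : Integrable (fun x => tilt t x y * ‖x‖ ^ 2) μ) :
    ‖tiltMean μ t y‖ ^ 2 / evidence μ t y ≤ ∫ x, tilt t x y * ‖x‖ ^ 2 ∂μ := by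
  rcases (evidence_nonneg μ t y).eq_or_lt with h | h
  · rw [← h, div_zero]
    exact integral_nonneg fun x => mul_nonneg (tilt_pos _ _ _).le (sq_nonneg _)
  set m : E := (evidence μ t y)⁻¹ • tiltMean μ t y with hm
  have h3 : Integrable (fun x => inner ℝ m (tilt t x y • x)) μ := h1.const_inner m
  have key : 0 ≤ ∫ x, tilt t x y * ‖x - m‖ ^ 2 ∂μ :=
    integral_nonneg fun x => mul_nonneg (tilt_pos _ _ _).le (sq_nonneg _)
  have e : ∀ x, tilt t x y * ‖x - m‖ ^ 2 =
      tilt t x y * ‖x‖ ^ 2 - 2 * inner ℝ m (tilt t x y • x) + tilt t x y * ‖m‖ ^ 2 := fun x => by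
    rw [norm_sub_sq_real, inner_smul_right m x (tilt t x y), real_inner_comm m x]; ring
  simp_rw [e] at key
  have h4 : Integrable (fun x => tilt t x y * ‖x‖ ^ 2 - 2 * inner ℝ m (tilt t x y • x)) μ :=
    h2.sub (h3.const_mul 2)
  rw [integral_add h4 (h0.mul_const _),
    integral_sub h2 (h3.const_mul 2), integral_const_mul, integral_inner h1,
    integral_mul_const] at key
  change 0 ≤ _ - 2 * inner ℝ m (tiltMean μ t y) + evidence μ t y * _ at key
  have e1 : (inner ℝ m (tiltMean μ t y) : ℝ) = ‖tiltMean μ t y‖ ^ 2 / evidence μ t y := by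
    rw [hm, inner_smul_left, real_inner_self_eq_norm_sq]; simp; field_simp
  have e2 : evidence μ t y * ‖m‖ ^ 2 = ‖tiltMean μ t y‖ ^ 2 / evidence μ t y := by
    rw [hm, norm_smul, mul_pow, norm_inv, Real.norm_of_nonneg h.le]; field_simp
  rw [e1, e2] at key
  linarith

lemma integrable_tiltMean (hμ : Integrable (fun x => x) μ) {t : ℝ} (ht : 0 ≤ t) :
    Integrable (fun v => tiltMean μ t (Real.sqrt t • v)) (stdGaussian E) :=
  (integrable_tilt_smul_prod hμ ht).integral_prod_left

lemma integral_tiltMean (hμ : Integrable (fun x => x) μ) {t : ℝ} (ht : 0 ≤ t) :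
    ∫ v, tiltMean μ t (Real.sqrt t • v) ∂(stdGaussian E) = ∫ x, x ∂μ :=
  integral_integral_tilt_smul hμ ht

variable [IsFiniteMeasure μ]

lemma integrable_evidence {t : ℝ} (ht : 0 ≤ t) :
    Integrable (fun v => evidence μ t (Real.sqrt t • v)) (stdGaussian E) := by
  have :=
    (integrable_tilt_smul_prod (integrable_const (1 : ℝ) : Integrable _ μ) ht).integral_prod_left
  simpa [evidence] using this

lemma integral_evidence {t : ℝ} (ht : 0 ≤ t) :
    ∫ v, evidence μ t (Real.sqrt t • v) ∂(stdGaussian E) = μ.real Set.univ := by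
  have := integral_integral_tilt_smul (integrable_const (1 : ℝ) : Integrable _ μ) ht
  simpa [evidence] using this

lemma ae_integrable_tilt {t : ℝ} (ht : 0 ≤ t) :
    ∀ᵐ v ∂(stdGaussian E), Integrable (fun x => tilt t x (Real.sqrt t • v)) μ := by
  have := (integrable_tilt_smul_prod (integrable_const (1 : ℝ) : Integrable _ μ) ht).prod_right_ae
  simpa using this

end Fubini

section Bounded

variable {E : Type*} [NormedAddCommGroup E] [InnerProductSpace ℝ E] [FiniteDimensional ℝ E]
  [MeasurableSpace E] [BorelSpace E] {μ : Measure E} [IsFiniteMeasure μ] {R : ℝ}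

lemma integrable_tilt_of_bounded (hR : ∀ᵐ x ∂μ, ‖x‖ ≤ R) {t : ℝ} (ht : 0 ≤ t) (y : E) :
    Integrable (fun x => tilt t x y) μ := by
  refine Integrable.of_bound (C := Real.exp (R * ‖y‖)) (by unfold tilt; fun_prop) ?_
  filter_upwards [hR] with x hx
  rw [Real.norm_of_nonneg (tilt_pos _ _ _).le]
  exact tilt_le_exp_mul_norm ht hx y

lemma integrable_tilt_smul_of_bounded (hR : ∀ᵐ x ∂μ, ‖x‖ ≤ R) {t : ℝ} (ht : 0 ≤ t) (y : E) :
    Integrable (fun x => tilt t x y • x) μ := by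
  refine Integrable.of_bound (C := Real.exp (R * ‖y‖) * R) (by unfold tilt; fun_prop) ?_
  filter_upwards [hR] with x hx
  rw [norm_smul, Real.norm_of_nonneg (tilt_pos _ _ _).le]
  gcongr
  exact tilt_le_exp_mul_norm ht hx y

lemma integrable_tilt_of_pos {t : ℝ} (ht : 0 < t) (y : E) :
    Integrable (fun x => tilt t x y) μ := by
  refine Integrable.of_bound (C := Real.exp (‖y‖ ^ 2 / (2 * t))) (by unfold tilt; fun_prop)
    (Filter.Eventually.of_forall fun x => ?_)
  rw [Real.norm_of_nonneg (tilt_pos _ _ _).le]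
  exact tilt_le_of_pos ht x y

lemma evidence_le_of_bounded (hR : ∀ᵐ x ∂μ, ‖x‖ ≤ R) {t : ℝ} (ht : 0 ≤ t) (y : E) :
    evidence μ t y ≤ μ.real Set.univ * Real.exp (R * ‖y‖) := by
  have h : evidence μ t y ≤ ∫ _, Real.exp (R * ‖y‖) ∂μ := by
    refine integral_mono_ae (integrable_tilt_of_bounded hR ht y) (integrable_const _) ?_
    filter_upwards [hR] with x hx using tilt_le_exp_mul_norm ht hx y
  simpa using h

lemma norm_tiltMean_le_of_bounded (hR : ∀ᵐ x ∂μ, ‖x‖ ≤ R) {t : ℝ} (ht : 0 ≤ t) (y : E) :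
    ‖tiltMean μ t y‖ ≤ R * evidence μ t y := by
  refine (norm_integral_le_integral_norm _).trans ?_
  rw [evidence, ← integral_const_mul]
  refine integral_mono_ae (integrable_tilt_smul_of_bounded hR ht y).norm
    ((integrable_tilt_of_bounded hR ht y).const_mul R) ?_
  filter_upwards [hR] with x hx
  rw [norm_smul, Real.norm_of_nonneg (tilt_pos _ _ _).le, mul_comm]
  gcongr
  exact (tilt_pos _ _ _).le

end Bounded

/-! ### Relative entropy and energy of the posterior mean -/

section Energies

variable {E : Type*} [NormedAddCommGroup E] [InnerProductSpace ℝ E] [FiniteDimensional ℝ E]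
  [MeasurableSpace E] [BorelSpace E]

/-- The divergence of the law of the observation at time `t` from that of pure noise, for a signal
of law `μ`. The formula is used for unnormalized `μ` too. -/
noncomputable def relEnt (μ : Measure E) (t : ℝ) : ℝ :=
  ∫ v, evidence μ t (Real.sqrt t • v) * Real.log (evidence μ t (Real.sqrt t • v)) ∂(stdGaussian E)

/-- The second moment of the posterior mean at time `t`, for a signal of law `μ`. The formula is
used for unnormalized `μ` too. -/
noncomputable def estEnergy (μ : Measure E) (t : ℝ) : ℝ :=
  ∫ v, ‖tiltMean μ t (Real.sqrt t • v)‖ ^ 2 / evidence μ t (Real.sqrt t • v) ∂(stdGaussian E)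

lemma integrable_sq_of_memLp {μ : Measure E} (hμ : MemLp (fun x => x) 2 μ) :
    Integrable (fun x : E => ‖x‖ ^ 2) μ :=
  (memLp_two_iff_integrable_sq_norm hμ.1).1 hμ

variable {μ : Measure E} [IsFiniteMeasure μ]

lemma integrable_of_memLp (hμ : MemLp (fun x => x) 2 μ) : Integrable (fun x : E => x) μ :=
  hμ.integrable (by norm_num)

lemma ae_norm_tiltMean_sq_div_le (hμ : MemLp (fun x => x) 2 μ) {t : ℝ} (ht : 0 ≤ t) :
    ∀ᵐ v ∂(stdGaussian E),
      ‖tiltMean μ t (Real.sqrt t • v)‖ ^ 2 / evidence μ t (Real.sqrt t • v) ≤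
        ∫ x, tilt t x (Real.sqrt t • v) * ‖x‖ ^ 2 ∂μ := by
  filter_upwards [ae_integrable_tilt (μ := μ) ht,
    ae_integrable_tilt_smul (integrable_of_memLp hμ) ht,
    ae_integrable_tilt_smul (integrable_sq_of_memLp hμ) ht] with v h0 h1 h2
  exact norm_tiltMean_sq_div_le h0 h1 h2

lemma integrable_estEnergy (hμ : MemLp (fun x => x) 2 μ) {t : ℝ} (ht : 0 ≤ t) :
    Integrable (fun v => ‖tiltMean μ t (Real.sqrt t • v)‖ ^ 2 /
      evidence μ t (Real.sqrt t • v)) (stdGaussian E) := by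
  refine (integrable_tilt_smul_prod (integrable_sq_of_memLp hμ) ht).integral_prod_left.mono'
    (Measurable.aestronglyMeasurable (by fun_prop)) ?_
  filter_upwards [ae_norm_tiltMean_sq_div_le hμ ht] with v hv
  rwa [Real.norm_of_nonneg (div_nonneg (sq_nonneg _) (evidence_nonneg _ _ _))]

lemma tiltMean_zero (μ : Measure E) : tiltMean μ 0 0 = ∫ x, x ∂μ := by simp [tiltMean]

lemma relEnt_zero (μ : Measure E) :
    relEnt μ 0 = μ.real Set.univ * Real.log (μ.real Set.univ) := by
  simp [relEnt, evidence_zero]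

lemma estEnergy_zero (μ : Measure E) :
    estEnergy μ 0 = ‖∫ x, x ∂μ‖ ^ 2 / μ.real Set.univ := by
  simp [estEnergy, evidence_zero, tiltMean_zero]

/-- The posterior mean gains energy as the observation improves: `(u, l) ↦ ‖u‖² / l` is convex, so
it lies above the tangent `2 ⟪c, u⟫ - ‖c‖² l` at the prior. -/
lemma estEnergy_zero_le (hμ : MemLp (fun x => x) 2 μ) {t : ℝ} (ht : 0 ≤ t) :
    estEnergy μ 0 ≤ estEnergy μ t := by
  rcases eq_or_ne μ 0 with rfl | hne
  · simp [estEnergy, evidence]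
  have : NeZero μ := ⟨hne⟩
  have hp : 0 < μ.real Set.univ := by
    rw [← evidence_zero]; exact evidence_pos (by simp)
  set u : E := ∫ x, x ∂μ with hu
  set c : E := (μ.real Set.univ)⁻¹ • u with hc
  have hi := integrable_of_memLp hμ
  have h1 := (integrable_tiltMean hi ht).const_inner (𝕜 := ℝ) c
  have h2 := integrable_evidence (μ := μ) ht
  have key : ∫ v, (2 * inner ℝ c (tiltMean μ t (Real.sqrt t • v)) -
      ‖c‖ ^ 2 * evidence μ t (Real.sqrt t • v)) ∂(stdGaussian E) ≤ estEnergy μ t := by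
    refine integral_mono_ae ((h1.const_mul 2).sub (h2.const_mul _))
      (integrable_estEnergy hμ ht) ?_
    filter_upwards [ae_integrable_tilt (μ := μ) ht] with v hv
    have hL := evidence_pos hv
    rw [le_div_iff₀ hL]
    have h3 := sq_nonneg ‖tiltMean μ t (Real.sqrt t • v) - evidence μ t (Real.sqrt t • v) • c‖
    rw [norm_sub_sq_real, inner_smul_right, norm_smul, mul_pow, Real.norm_of_nonneg hL.le,
      real_inner_comm] at h3
    nlinarith [h3]
  rw [integral_sub (h1.const_mul 2) (h2.const_mul _), integral_const_mul, integral_const_mul,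
    integral_inner (integrable_tiltMean hi ht), integral_tiltMean hi ht, integral_evidence ht,
    ← hu] at key
  refine le_trans (le_of_eq ?_) key
  rw [estEnergy_zero, ← hu, hc, inner_smul_left, real_inner_self_eq_norm_sq, norm_smul, mul_pow,
    Real.norm_of_nonneg (inv_nonneg.2 hp.le)]
  simp; field_simp; ring

end Energies

section Step

variable {E : Type*} [NormedAddCommGroup E] [InnerProductSpace ℝ E] [FiniteDimensional ℝ E]
  [MeasurableSpace E] [BorelSpace E] {μ : Measure E} [IsFiniteMeasure μ] {R : ℝ}

lemma memLp_of_bounded (hR : ∀ᵐ x ∂μ, ‖x‖ ≤ R) : MemLp (fun x : E => x) 2 μ :=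
  MemLp.of_bound (by fun_prop) R hR

lemma abs_mul_log_le {y : ℝ} (hy : 0 ≤ y) : |y * Real.log y| ≤ 1 + y ^ 2 := by
  rcases hy.eq_or_lt with rfl | h
  · simp
  have h1 := Real.log_le_sub_one_of_pos h
  have h2 := Real.one_sub_inv_le_log_of_pos h
  rw [abs_le]
  constructor
  · have := mul_le_mul_of_nonneg_left h2 h.le
    have h3 : y * (1 - y⁻¹) = y - 1 := by field_simp
    nlinarith
  · have := mul_le_mul_of_nonneg_left h1 h.le
    nlinarith

lemma evidence_sqrt_le_of_bounded (hR : ∀ᵐ x ∂μ, ‖x‖ ≤ R) {t : ℝ} (ht : 0 ≤ t) (v : E) :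
    evidence μ t (Real.sqrt t • v) ≤ μ.real Set.univ * Real.exp (R * Real.sqrt t * ‖v‖) := by
  refine (evidence_le_of_bounded hR ht _).trans_eq ?_
  rw [norm_smul, Real.norm_of_nonneg (Real.sqrt_nonneg t), mul_assoc]

lemma integrable_relEnt_of_bounded (hR : ∀ᵐ x ∂μ, ‖x‖ ≤ R) {t : ℝ} (ht : 0 ≤ t) :
    Integrable (fun v => evidence μ t (Real.sqrt t • v) *
      Real.log (evidence μ t (Real.sqrt t • v))) (stdGaussian E) := by
  refine ((integrable_const (1 : ℝ)).add ((integrable_exp_mul_norm_stdGaussian (E := E)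
    (2 * (R * Real.sqrt t))).const_mul (μ.real Set.univ ^ 2))).mono'
    (Measurable.aestronglyMeasurable (by fun_prop)) ?_
  refine Filter.Eventually.of_forall fun v => ?_
  refine (abs_mul_log_le (evidence_nonneg _ _ _)).trans ?_
  have := pow_le_pow_left₀ (evidence_nonneg _ _ _) (evidence_sqrt_le_of_bounded hR ht v) 2
  rw [mul_pow, ← Real.exp_nat_mul] at this
  push_cast at this
  rw [← mul_assoc] at this
  simpa using this

end Step

/-! ### The short-time estimate for signals of bounded support -/

section ChiSquare

variable {E : Type*} [NormedAddCommGroup E] [InnerProductSpace ℝ E] [FiniteDimensional ℝ E]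
  [MeasurableSpace E] [BorelSpace E] {μ : Measure E} [IsFiniteMeasure μ] {R : ℝ}

lemma ae_abs_inner_sub_le (hR : ∀ᵐ x ∂μ, ‖x‖ ≤ R) {m : E} (hm : ‖m‖ ≤ R) :
    ∀ᵐ z ∂(μ.prod μ), |inner ℝ (z.1 - m) (z.2 - m)| ≤ 4 * R ^ 2 := by
  filter_upwards [Measure.quasiMeasurePreserving_fst.ae hR,
    Measure.quasiMeasurePreserving_snd.ae hR] with z h1 h2
  refine (abs_real_inner_le_norm _ _).trans ?_
  have h3 : ‖z.1 - m‖ ≤ 2 * R := (norm_sub_le _ _).trans (by linarith)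
  have h4 : ‖z.2 - m‖ ≤ 2 * R := (norm_sub_le _ _).trans (by linarith)
  calc ‖z.1 - m‖ * ‖z.2 - m‖ ≤ (2 * R) * (2 * R) :=
        mul_le_mul h3 h4 (norm_nonneg _) ((norm_nonneg _).trans h3)
    _ = 4 * R ^ 2 := by ring

lemma tilt_mul_tilt_div (h : ℝ) (x x' m y : E) :
    tilt h x y * tilt h x' y / tilt h m y =
      tilt h (x + x' - m) y * Real.exp (h * inner ℝ (x - m) (x' - m)) := by
  simp only [tilt]
  rw [← Real.exp_add, ← Real.exp_sub, ← Real.exp_add]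
  congr 1
  have e : ‖x + x' - m‖ ^ 2 = ‖x‖ ^ 2 + ‖x'‖ ^ 2 + ‖m‖ ^ 2 + 2 * inner ℝ x x' - 2 * inner ℝ x m
      - 2 * inner ℝ x' m := by
    rw [norm_sub_sq_real, norm_add_sq_real, inner_add_left]; ring
  rw [e, inner_sub_left, inner_add_left, inner_sub_left, inner_sub_right, inner_sub_right,
    real_inner_self_eq_norm_sq, real_inner_comm x' m]
  ring

lemma integrable_exp_inner_sub (hR : ∀ᵐ x ∂μ, ‖x‖ ≤ R) {m : E} (hm : ‖m‖ ≤ R) {h : ℝ}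
    (hh : 0 ≤ h) : Integrable (fun z : E × E => Real.exp (h * inner ℝ (z.1 - m) (z.2 - m)))
      (μ.prod μ) := by
  refine Integrable.of_bound (C := Real.exp (h * (4 * R ^ 2))) (by fun_prop) ?_
  filter_upwards [ae_abs_inner_sub_le hR hm] with z hz
  rw [Real.norm_of_nonneg (Real.exp_pos _).le, Real.exp_le_exp]
  gcongr
  exact (le_abs_self _).trans hz

lemma integrable_chiSq_prod (hR : ∀ᵐ x ∂μ, ‖x‖ ≤ R) {m : E} (hm : ‖m‖ ≤ R) {h : ℝ}
    (hh : 0 ≤ h) : Integrable (fun p : E × (E × E) =>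
      tilt h (p.2.1 + p.2.2 - m) (Real.sqrt h • p.1) *
        Real.exp (h * inner ℝ (p.2.1 - m) (p.2.2 - m))) ((stdGaussian E).prod (μ.prod μ)) := by
  rw [integrable_prod_iff' (by unfold tilt; fun_prop)]
  refine ⟨Filter.Eventually.of_forall fun z =>
    (integrable_tilt_stdGaussian hh (z.1 + z.2 - m)).mul_const
      (Real.exp (h * inner ℝ (z.1 - m) (z.2 - m))), ?_⟩
  simp_rw [norm_mul, integral_mul_const, Real.norm_of_nonneg (tilt_pos _ _ _).le,
    integral_tilt_stdGaussian hh, one_mul]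
  exact (integrable_exp_inner_sub hR hm hh).norm

lemma evidence_sq_div_tilt (h : ℝ) (m y : E) :
    evidence μ h y ^ 2 / tilt h m y = ∫ z, tilt h (z.1 + z.2 - m) y *
        Real.exp (h * inner ℝ (z.1 - m) (z.2 - m)) ∂(μ.prod μ) := by
  simp_rw [← tilt_mul_tilt_div, integral_div]
  rw [integral_prod_mul (fun x => tilt h x y) (fun x => tilt h x y), evidence, sq]

/-- The second moment of the likelihood ratio of two mixtures of Gaussian translates is an
exponential moment of the prior. -/
lemma integral_evidence_sq_div_tilt (hR : ∀ᵐ x ∂μ, ‖x‖ ≤ R) {m : E} (hm : ‖m‖ ≤ R) {h : ℝ}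
    (hh : 0 ≤ h) :
    ∫ v, evidence μ h (Real.sqrt h • v) ^ 2 / tilt h m (Real.sqrt h • v) ∂(stdGaussian E) =
      ∫ z, Real.exp (h * inner ℝ (z.1 - m) (z.2 - m)) ∂(μ.prod μ) := by
  simp_rw [evidence_sq_div_tilt]
  rw [integral_integral_swap (f := fun (v : E) (z : E × E) =>
    tilt h (z.1 + z.2 - m) (Real.sqrt h • v) * Real.exp (h * inner ℝ (z.1 - m) (z.2 - m)))
    (integrable_chiSq_prod hR hm hh)]
  simp_rw [integral_mul_const, integral_tilt_stdGaussian hh, one_mul]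

lemma integrable_evidence_sq_div_tilt (hR : ∀ᵐ x ∂μ, ‖x‖ ≤ R) {m : E} (hm : ‖m‖ ≤ R) {h : ℝ}
    (hh : 0 ≤ h) : Integrable (fun v => evidence μ h (Real.sqrt h • v) ^ 2 /
      tilt h m (Real.sqrt h • v)) (stdGaussian E) := by
  simp_rw [evidence_sq_div_tilt]
  exact (integrable_chiSq_prod hR hm hh).integral_prod_left

/-- For a centering `m` at the mean, the first-order term of the exponential moment vanishes. -/
lemma integral_exp_inner_sub_le (hR : ∀ᵐ x ∂μ, ‖x‖ ≤ R) {m : E} (hm : ‖m‖ ≤ R)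
    (hmean : ∫ x, x ∂μ = μ.real Set.univ • m) {h : ℝ} (hh : 0 ≤ h) (hh1 : h * (4 * R ^ 2) ≤ 1) :
    ∫ z, Real.exp (h * inner ℝ (z.1 - m) (z.2 - m)) ∂(μ.prod μ) ≤
      μ.real Set.univ ^ 2 * (1 + 16 * R ^ 4 * h ^ 2) := by
  have hi := integrable_of_memLp (memLp_of_bounded hR)
  have hin : Integrable (fun z : E × E => (inner ℝ (z.1 - m) (z.2 - m) : ℝ)) (μ.prod μ) :=
    Integrable.of_bound (C := 4 * R ^ 2) (by fun_prop) (ae_abs_inner_sub_le hR hm)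
  have hzero : ∫ z, (inner ℝ (z.1 - m) (z.2 - m) : ℝ) ∂(μ.prod μ) = 0 := by
    rw [integral_prod _ hin]
    have hs : ∫ y, (y - m) ∂μ = 0 := by
      rw [integral_sub hi (integrable_const _), hmean]; simp
    have : ∀ x, ∫ y, (inner ℝ (x - m) (y - m) : ℝ) ∂μ = 0 := fun x => by
      rw [integral_inner (f := fun y => y - m) (hi.sub (integrable_const m)) (x - m), hs,
        inner_zero_right]
    simp [this]
  have hb : ∫ z, Real.exp (h * inner ℝ (z.1 - m) (z.2 - m)) ∂(μ.prod μ) ≤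
      ∫ z, ((1 + 16 * R ^ 4 * h ^ 2) + h * inner ℝ (z.1 - m) (z.2 - m)) ∂(μ.prod μ) := by
    refine integral_mono_ae (integrable_exp_inner_sub hR hm hh)
      ((integrable_const _).add (hin.const_mul h)) ?_
    filter_upwards [ae_abs_inner_sub_le hR hm] with z hz
    set i : ℝ := inner ℝ (z.1 - m) (z.2 - m)
    have h1 : |h * i| ≤ 1 := by
      rw [abs_mul, abs_of_nonneg hh]
      exact (mul_le_mul_of_nonneg_left hz hh).trans hh1
    have h2 := (abs_le.1 (Real.abs_exp_sub_one_sub_id_le h1)).2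
    have h3 : i ^ 2 ≤ (4 * R ^ 2) ^ 2 := sq_le_sq' (abs_le.1 hz).1 (abs_le.1 hz).2
    have h4 : (h * i) ^ 2 ≤ h ^ 2 * (4 * R ^ 2) ^ 2 := by
      rw [mul_pow]; gcongr
    change Real.exp (h * i) ≤ (1 + 16 * R ^ 4 * h ^ 2) + h * i
    nlinarith
  refine hb.trans_eq ?_
  rw [integral_add (integrable_const _) (hin.const_mul h), integral_const_mul, hzero]
  have : (μ.prod μ).real Set.univ = μ.real Set.univ ^ 2 := by
    rw [← Set.univ_prod_univ, measureReal_prod_prod, sq]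
  simp [this]

lemma integral_evidence_mul_inner (hR : ∀ᵐ x ∂μ, ‖x‖ ≤ R) (m : E) {h : ℝ} (hh : 0 ≤ h) :
    Integrable (fun v => evidence μ h (Real.sqrt h • v) * inner ℝ m v) (stdGaussian E) ∧
    ∫ v, evidence μ h (Real.sqrt h • v) * inner ℝ m v ∂(stdGaussian E) =
      Real.sqrt h * inner ℝ m (∫ x, x ∂μ) := by
  have hp : Integrable (fun p : E × E => tilt h p.2 (Real.sqrt h • p.1) * inner ℝ m p.1)
      ((stdGaussian E).prod μ) := by
    refine (((integrable_exp_mul_norm_stdGaussian (E := E) (R * Real.sqrt h + 1)).const_mul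
      ‖m‖).comp_fst μ).mono' (by unfold tilt; fun_prop) ?_
    filter_upwards [Measure.quasiMeasurePreserving_snd.ae hR] with p hp
    rw [norm_mul, Real.norm_of_nonneg (tilt_pos _ _ _).le, add_mul, Real.exp_add]
    have h1 := tilt_le_exp_mul_norm hh hp (Real.sqrt h • p.1)
    rw [norm_smul, Real.norm_of_nonneg (Real.sqrt_nonneg h), ← mul_assoc] at h1
    have h2 : ‖(inner ℝ m p.1 : ℝ)‖ ≤ ‖m‖ * Real.exp (1 * ‖p.1‖) := by
      refine (abs_real_inner_le_norm _ _).trans ?_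
      gcongr
      have := Real.add_one_le_exp (1 * ‖p.1‖)
      linarith
    calc _ ≤ Real.exp (R * Real.sqrt h * ‖p.1‖) * (‖m‖ * Real.exp (1 * ‖p.1‖)) := by gcongr
      _ = _ := by ring
  have e : ∀ v, evidence μ h (Real.sqrt h • v) * inner ℝ m v =
      ∫ x, tilt h x (Real.sqrt h • v) * inner ℝ m v ∂μ := fun v => by
    rw [integral_mul_const, evidence]
  simp_rw [e]
  refine ⟨hp.integral_prod_left, ?_⟩
  rw [integral_integral_swap (f := fun v x => tilt h x (Real.sqrt h • v) * inner ℝ m v) hp]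
  simp_rw [integral_tilt_mul_inner_stdGaussian hh, integral_const_mul]
  rw [integral_inner (integrable_of_memLp (memLp_of_bounded hR))]

/-- Over a short time the relative entropy grows at most by half the energy of the mean, up to a
quadratic error: the law of the observation is compared with the Gaussian law that has the same
mean, and the divergence between the two is at most their `χ²` divergence. -/
lemma relEnt_sub_relEnt_zero_le (hR : ∀ᵐ x ∂μ, ‖x‖ ≤ R) {h : ℝ} (hh : 0 ≤ h)
    (hh1 : h * (4 * R ^ 2) ≤ 1) :
    relEnt μ h - relEnt μ 0 ≤
      h / 2 * estEnergy μ 0 + 16 * R ^ 4 * h ^ 2 * μ.real Set.univ := by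
  rcases eq_or_ne μ 0 with rfl | hne
  · simp [relEnt, estEnergy, evidence]
  have : NeZero μ := ⟨hne⟩
  have hp : 0 < μ.real Set.univ := by
    rw [← evidence_zero]; exact evidence_pos (by simp)
  set p := μ.real Set.univ with hpdef
  set m : E := p⁻¹ • ∫ x, x ∂μ with hm
  have hmean : ∫ x, x ∂μ = p • m := by rw [hm, smul_inv_smul₀ hp.ne']
  have hmR : ‖m‖ ≤ R := by
    have := norm_tiltMean_le_of_bounded hR le_rfl 0
    rw [tiltMean_zero, evidence_zero, hmean, norm_smul, Real.norm_of_nonneg hp.le, mul_comm] at this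
    exact le_of_mul_le_mul_right this hp
  obtain ⟨hi1, he1⟩ := integral_evidence_mul_inner hR m hh
  have hi2 := integrable_evidence (μ := μ) hh
  have hi3 := integrable_evidence_sq_div_tilt hR hmR hh
  have hchi := (integral_evidence_sq_div_tilt hR hmR hh).trans_le
    (integral_exp_inner_sub_le hR hmR hmean hh hh1)
  have key : relEnt μ h ≤ ∫ v, ((evidence μ h (Real.sqrt h • v) *
      (Real.log p - h / 2 * ‖m‖ ^ 2 - 1) +
      Real.sqrt h * (evidence μ h (Real.sqrt h • v) * inner ℝ m v)) +
      p⁻¹ * (evidence μ h (Real.sqrt h • v) ^ 2 / tilt h m (Real.sqrt h • v)))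
        ∂(stdGaussian E) := by
    refine integral_mono (integrable_relEnt_of_bounded hR hh)
      (((hi2.mul_const _).add (hi1.const_mul _)).add (hi3.const_mul _)) fun v => ?_
    have hr : 0 < evidence μ h (Real.sqrt h • v) :=
      evidence_pos (integrable_tilt_of_bounded hR hh _)
    have hq := tilt_pos h m (Real.sqrt h • v)
    have hlogq : Real.log (tilt h m (Real.sqrt h • v)) =
        Real.sqrt h * inner ℝ m v - h / 2 * ‖m‖ ^ 2 := by
      rw [tilt, Real.log_exp, inner_smul_right]
    dsimp only
    set r := evidence μ h (Real.sqrt h • v)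
    set q := tilt h m (Real.sqrt h • v)
    have h1 := Real.log_le_sub_one_of_pos (div_pos hr (mul_pos hp hq))
    rw [Real.log_div hr.ne' (mul_pos hp hq).ne', Real.log_mul hp.ne' hq.ne', hlogq] at h1
    have h2 := mul_le_mul_of_nonneg_left h1 hr.le
    have h3 : r * (r / (p * q) - 1) = p⁻¹ * (r ^ 2 / q) - r := by field_simp
    rw [h3] at h2
    linarith
  have hsum : Integrable (fun v => evidence μ h (Real.sqrt h • v) *
      (Real.log p - h / 2 * ‖m‖ ^ 2 - 1) +
      Real.sqrt h * (evidence μ h (Real.sqrt h • v) * inner ℝ m v)) (stdGaussian E) :=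
    (hi2.mul_const _).add (hi1.const_mul _)
  rw [integral_add hsum (hi3.const_mul _), integral_add (hi2.mul_const _) (hi1.const_mul _),
    integral_mul_const, integral_const_mul, integral_const_mul, integral_evidence hh, he1, hmean,
    inner_smul_right, real_inner_self_eq_norm_sq, ← hpdef, ← mul_assoc,
    Real.mul_self_sqrt hh] at key
  have h5 : p⁻¹ * ∫ v, evidence μ h (Real.sqrt h • v) ^ 2 / tilt h m (Real.sqrt h • v)
      ∂(stdGaussian E) ≤ p⁻¹ * (p ^ 2 * (1 + 16 * R ^ 4 * h ^ 2)) := by gcongr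
  have h6 : p⁻¹ * (p ^ 2 * (1 + 16 * R ^ 4 * h ^ 2)) = p * (1 + 16 * R ^ 4 * h ^ 2) := by
    field_simp
  have h7 : estEnergy μ 0 = p * ‖m‖ ^ 2 := by
    rw [estEnergy_zero, hmean, norm_smul, mul_pow, Real.norm_of_nonneg hp.le, ← hpdef]; field_simp
  rw [relEnt_zero, ← hpdef, h7]
  rw [h6] at h5
  linarith

end ChiSquare

/-! ### The semigroup property and integration of the short-time estimate -/

section Semigroup

variable {E : Type*} [NormedAddCommGroup E] [InnerProductSpace ℝ E] [FiniteDimensional ℝ E]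
  [MeasurableSpace E] [BorelSpace E] {μ : Measure E}

/-- The unnormalized posterior law of the signal given the observation `y` at time `t`. -/
noncomputable def tiltedMeasure (μ : Measure E) (t : ℝ) (y : E) : Measure E :=
  μ.withDensity fun x => ENNReal.ofReal (tilt t x y)

lemma measurable_tilt_left (t : ℝ) (y : E) : Measurable fun x : E => tilt t x y := by
  unfold tilt; fun_prop

/-- The posterior at time `s` serves as the prior for the observations after time `s`. -/
lemma evidence_tiltedMeasure (s t : ℝ) (w y : E) :
    evidence (tiltedMeasure μ s w) t y = evidence μ (s + t) (w + y) := by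
  rw [evidence, tiltedMeasure, integral_withDensity_eq_integral_toReal_smul
    (measurable_tilt_left s w).ennreal_ofReal (by simp)]
  simp_rw [ENNReal.toReal_ofReal (tilt_pos _ _ _).le, smul_eq_mul, ← tilt_add]
  rfl

lemma tiltMean_tiltedMeasure (s t : ℝ) (w y : E) :
    tiltMean (tiltedMeasure μ s w) t y = tiltMean μ (s + t) (w + y) := by
  rw [tiltMean, tiltedMeasure, integral_withDensity_eq_integral_toReal_smul
    (measurable_tilt_left s w).ennreal_ofReal (by simp)]
  simp_rw [ENNReal.toReal_ofReal (tilt_pos _ _ _).le, smul_smul, ← tilt_add]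
  rfl

lemma isFiniteMeasure_tiltedMeasure {t : ℝ} {y : E} (h : Integrable (fun x => tilt t x y) μ) :
    IsFiniteMeasure (tiltedMeasure μ t y) :=
  isFiniteMeasure_withDensity_ofReal h.2

lemma integral_add_smul_stdGaussian {F : E → ℝ} (hF : Measurable F) {a h : ℝ} (ha : 0 ≤ a)
    (hh : 0 ≤ h) (hi : Integrable (fun v => F (Real.sqrt (a + h) • v)) (stdGaussian E)) :
    Integrable (fun v => ∫ v', F (Real.sqrt a • v + Real.sqrt h • v') ∂(stdGaussian E))
      (stdGaussian E) ∧
    ∫ v, F (Real.sqrt (a + h) • v) ∂(stdGaussian E) =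
      ∫ v, ∫ v', F (Real.sqrt a • v + Real.sqrt h • v') ∂(stdGaussian E) ∂(stdGaussian E) := by
  have hi' : Integrable F ((stdGaussian E).map (fun v => Real.sqrt (a + h) • v)) := by
    rwa [integrable_map_measure hF.aestronglyMeasurable (by fun_prop)]
  rw [← map_add_smul_stdGaussian ha hh, integrable_map_measure hF.aestronglyMeasurable
    (by fun_prop)] at hi'
  refine ⟨hi'.integral_prod_left, ?_⟩
  rw [← integral_map (φ := fun v : E => Real.sqrt (a + h) • v) (by fun_prop)
    hF.aestronglyMeasurable, ← map_add_smul_stdGaussian ha hh,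
    integral_map (by fun_prop) hF.aestronglyMeasurable]
  exact integral_prod _ hi'

variable [IsFiniteMeasure μ] {R : ℝ}

lemma tiltedMeasure_bounded (hR : ∀ᵐ x ∂μ, ‖x‖ ≤ R) (t : ℝ) (y : E) :
    ∀ᵐ x ∂(tiltedMeasure μ t y), ‖x‖ ≤ R :=
  (withDensity_absolutelyContinuous μ _).ae_le hR

lemma relEnt_add_of_bounded (hR : ∀ᵐ x ∂μ, ‖x‖ ≤ R) {a h : ℝ} (ha : 0 ≤ a) (hh : 0 ≤ h) :
    Integrable (fun v => relEnt (tiltedMeasure μ a (Real.sqrt a • v)) h) (stdGaussian E) ∧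
    relEnt μ (a + h) =
      ∫ v, relEnt (tiltedMeasure μ a (Real.sqrt a • v)) h ∂(stdGaussian E) := by
  have := integral_add_smul_stdGaussian
    (F := fun y => evidence μ (a + h) y * Real.log (evidence μ (a + h) y))
    (by fun_prop) ha hh (integrable_relEnt_of_bounded hR (add_nonneg ha hh))
  simpa only [relEnt, evidence_tiltedMeasure] using this

lemma estEnergy_add_of_memLp (hμ : MemLp (fun x => x) 2 μ) {a h : ℝ} (ha : 0 ≤ a) (hh : 0 ≤ h) :
    Integrable (fun v => estEnergy (tiltedMeasure μ a (Real.sqrt a • v)) h) (stdGaussian E) ∧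
    estEnergy μ (a + h) =
      ∫ v, estEnergy (tiltedMeasure μ a (Real.sqrt a • v)) h ∂(stdGaussian E) := by
  have := integral_add_smul_stdGaussian
    (F := fun y => ‖tiltMean μ (a + h) y‖ ^ 2 / evidence μ (a + h) y)
    (by fun_prop) ha hh (integrable_estEnergy hμ (add_nonneg ha hh))
  simpa only [estEnergy, evidence_tiltedMeasure, tiltMean_tiltedMeasure] using this

lemma relEnt_tiltedMeasure_zero (t : ℝ) (y : E) :
    relEnt (tiltedMeasure μ t y) 0 = evidence μ t y * Real.log (evidence μ t y) := by
  simp [relEnt, evidence_tiltedMeasure]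

lemma estEnergy_tiltedMeasure_zero (t : ℝ) (y : E) :
    estEnergy (tiltedMeasure μ t y) 0 = ‖tiltMean μ t y‖ ^ 2 / evidence μ t y := by
  simp [estEnergy, evidence_tiltedMeasure, tiltMean_tiltedMeasure]

lemma estEnergy_le_of_bounded (hR : ∀ᵐ x ∂μ, ‖x‖ ≤ R) {a b : ℝ} (ha : 0 ≤ a) (hab : a ≤ b) :
    estEnergy μ a ≤ estEnergy μ b := by
  have hμ := memLp_of_bounded hR
  have h := estEnergy_add_of_memLp hμ ha (sub_nonneg.2 hab)
  rw [add_sub_cancel] at h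
  rw [h.2, estEnergy]
  refine integral_mono (integrable_estEnergy hμ ha) h.1 fun v => ?_
  have := isFiniteMeasure_tiltedMeasure
    (integrable_tilt_of_bounded hR ha (Real.sqrt a • v))
  dsimp only
  rw [← estEnergy_tiltedMeasure_zero]
  exact estEnergy_zero_le (memLp_of_bounded (tiltedMeasure_bounded hR _ _)) (sub_nonneg.2 hab)

lemma relEnt_add_sub_le_of_bounded (hR : ∀ᵐ x ∂μ, ‖x‖ ≤ R) {a h : ℝ} (ha : 0 ≤ a) (hh : 0 ≤ h)
    (hh1 : h * (4 * R ^ 2) ≤ 1) :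
    relEnt μ (a + h) - relEnt μ a ≤
      h / 2 * estEnergy μ a + 16 * R ^ 4 * h ^ 2 * μ.real Set.univ := by
  obtain ⟨h1, h2⟩ := relEnt_add_of_bounded hR ha hh
  have h3 := integrable_relEnt_of_bounded hR ha
  have h4 := integrable_estEnergy (memLp_of_bounded hR) ha
  have h5 := integrable_evidence (μ := μ) ha
  rw [h2, ← integral_evidence ha, relEnt, estEnergy, ← integral_sub h1 h3, ← integral_const_mul,
    ← integral_const_mul, ← integral_add (h4.const_mul _) (h5.const_mul _)]
  refine integral_mono (h1.sub h3) ((h4.const_mul _).add (h5.const_mul _)) fun v => ?_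
  have := isFiniteMeasure_tiltedMeasure
    (integrable_tilt_of_bounded hR ha (Real.sqrt a • v))
  have h6 := relEnt_sub_relEnt_zero_le (tiltedMeasure_bounded hR a (Real.sqrt a • v)) hh hh1
  rw [relEnt_tiltedMeasure_zero, estEnergy_tiltedMeasure_zero, ← evidence_zero,
    evidence_tiltedMeasure, add_zero, add_zero] at h6
  exact h6

/-- For signals of bounded support, the relative entropy grows at most at the rate given by the
energy of the posterior mean at the end of the interval: the quadratic errors of the steps of a
subdivision vanish in the limit. -/
lemma relEnt_sub_le_of_bounded (hR : ∀ᵐ x ∂μ, ‖x‖ ≤ R) {a b : ℝ} (ha : 0 ≤ a) (hab : a ≤ b) :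
    relEnt μ b - relEnt μ a ≤ (b - a) / 2 * estEnergy μ b := by
  set C := 16 * R ^ 4 * μ.real Set.univ with hC
  have step : ∀ n : ℕ, 0 < n → (b - a) / n * (4 * R ^ 2) ≤ 1 →
      relEnt μ b - relEnt μ a ≤ (b - a) / 2 * estEnergy μ b + C * (b - a) ^ 2 / n := by
    intro n hn hn1
    have hn' : (0 : ℝ) < n := by exact_mod_cast hn
    set η := (b - a) / n with hη
    have hη0 : 0 ≤ η := div_nonneg (sub_nonneg.2 hab) hn'.le
    have hηn : n * η = b - a := by rw [hη]; field_simp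
    have ind : ∀ j : ℕ, j ≤ n →
        relEnt μ (a + j * η) - relEnt μ a ≤ j * (η / 2 * estEnergy μ b + C * η ^ 2) := by
      intro j
      induction j with
      | zero => intro; simp
      | succ j ih =>
        intro hj
        have h0 : 0 ≤ a + j * η := by positivity
        have h1 := ih (by omega)
        have h2 := relEnt_add_sub_le_of_bounded hR h0 hη0 hn1
        have h3 : estEnergy μ (a + j * η) ≤ estEnergy μ b := by
          refine estEnergy_le_of_bounded hR h0 ?_
          have : (j : ℝ) ≤ n := by exact_mod_cast (by omega : j ≤ n)
          nlinarith
        have h4 : η / 2 * estEnergy μ (a + j * η) ≤ η / 2 * estEnergy μ b := by gcongr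
        have h5 : a + ((j + 1 : ℕ) : ℝ) * η = a + j * η + η := by push_cast; ring
        rw [h5]
        push_cast
        have h6 : 16 * R ^ 4 * η ^ 2 * μ.real Set.univ = C * η ^ 2 := by rw [hC]; ring
        rw [h6] at h2
        linarith
    have h1 := ind n le_rfl
    rw [hηn, add_sub_cancel] at h1
    refine h1.trans_eq ?_
    rw [hη]; field_simp
  have lim : Filter.Tendsto (fun n : ℕ => (b - a) / 2 * estEnergy μ b + C * (b - a) ^ 2 / n)
      Filter.atTop (nhds ((b - a) / 2 * estEnergy μ b + 0)) :=
    (tendsto_const_div_atTop_nhds_zero_nat _).const_add _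
  rw [add_zero] at lim
  refine ge_of_tendsto lim ?_
  have lim2 : Filter.Tendsto (fun n : ℕ => (b - a) / n * (4 * R ^ 2)) Filter.atTop
      (nhds (0 * (4 * R ^ 2))) := (tendsto_const_div_atTop_nhds_zero_nat _).mul_const _
  rw [zero_mul] at lim2
  filter_upwards [Filter.eventually_gt_atTop 0, lim2.eventually (gt_mem_nhds one_pos)] with n h1 h2
  exact step n h1 h2.le

end Semigroup

/-! ### The joint law of signal and observation, and truncation of the signal -/

section JointLaw

variable {E : Type*} [NormedAddCommGroup E] [InnerProductSpace ℝ E] [FiniteDimensional ℝ E]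
  [MeasurableSpace E] [BorelSpace E] {μ : Measure E} [IsFiniteMeasure μ]

lemma measurable_tilt_prod (t : ℝ) :
    Measurable fun p : E × E => tilt t p.1 (Real.sqrt t • p.2) := by
  unfold tilt; fun_prop

lemma measurable_shift (t : ℝ) :
    Measurable fun p : E × E => (p.1, Real.sqrt t • p.1 + p.2) := by fun_prop

/-- The joint law of the signal and the normalized observation has density `tilt` with respect to
the product of the signal and pure noise. -/
lemma map_shift_eq_withDensity {t : ℝ} (ht : 0 ≤ t) :
    (μ.prod (stdGaussian E)).map (fun p => (p.1, Real.sqrt t • p.1 + p.2)) =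
      (μ.prod (stdGaussian E)).withDensity
        (fun p => ENNReal.ofReal (tilt t p.1 (Real.sqrt t • p.2))) := by
  refine Measure.ext_of_lintegral _ fun F hF => ?_
  rw [lintegral_map hF (measurable_shift t), lintegral_withDensity_eq_lintegral_mul _
    (measurable_tilt_prod t).ennreal_ofReal hF, lintegral_prod _
    (by fun_prop : Measurable fun p : E × E => F (p.1, Real.sqrt t • p.1 + p.2)).aemeasurable,
    lintegral_prod _ ((measurable_tilt_prod t).ennreal_ofReal.mul hF).aemeasurable]
  refine lintegral_congr fun x => ?_
  refine (lintegral_add_stdGaussian (F := fun v => F (x, v)) (by fun_prop)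
    (Real.sqrt t • x)).trans ?_
  simp_rw [← tilt_smul_eq t ht]
  rfl

lemma integrable_inner_prod (hμ : MemLp (fun x => x) 2 μ) :
    Integrable (fun p : E × E => (inner ℝ p.1 p.2 : ℝ)) (μ.prod (stdGaussian E)) := by
  have h1 := (hμ.integrable (by norm_num)).norm
  have h2 : Integrable (fun v : E => ‖v‖) (stdGaussian E) := IsGaussian.integrable_id.norm
  refine (h1.mul_prod h2).mono' (by fun_prop) (Filter.Eventually.of_forall fun p => ?_)
  exact abs_real_inner_le_norm _ _

lemma integral_inner_prod (hμ : MemLp (fun x => x) 2 μ) :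
    ∫ p : E × E, (inner ℝ p.1 p.2 : ℝ) ∂(μ.prod (stdGaussian E)) = 0 := by
  rw [integral_prod _ (integrable_inner_prod hμ)]
  have : ∀ x : E, ∫ v, (inner ℝ x v : ℝ) ∂(stdGaussian E) = 0 := fun x =>
    integral_strongDual_stdGaussian (innerSL ℝ x)
  simp [this]

lemma log_tilt_shift {t : ℝ} (ht : 0 ≤ t) (x v : E) :
    Real.log (tilt t x (Real.sqrt t • (Real.sqrt t • x + v))) =
      t / 2 * ‖x‖ ^ 2 + Real.sqrt t * inner ℝ x v := by
  rw [tilt, Real.log_exp, inner_smul_right, inner_add_right, inner_smul_right,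
    real_inner_self_eq_norm_sq, mul_add, ← mul_assoc, Real.mul_self_sqrt ht]
  ring

lemma integrable_log_tilt_shift (hμ : MemLp (fun x => x) 2 μ) {t : ℝ} (ht : 0 ≤ t) :
    Integrable (fun p : E × E => Real.log (tilt t p.1 (Real.sqrt t • (Real.sqrt t • p.1 + p.2))))
      (μ.prod (stdGaussian E)) := by
  simp_rw [log_tilt_shift ht]
  exact (((integrable_sq_of_memLp hμ).const_mul _).comp_fst _).add
    ((integrable_inner_prod hμ).const_mul _)

lemma integral_log_tilt_shift [IsProbabilityMeasure μ] (hμ : MemLp (fun x => x) 2 μ) {t : ℝ}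
    (ht : 0 ≤ t) :
    ∫ p : E × E, Real.log (tilt t p.1 (Real.sqrt t • (Real.sqrt t • p.1 + p.2)))
      ∂(μ.prod (stdGaussian E)) = t / 2 * ∫ x, ‖x‖ ^ 2 ∂μ := by
  simp_rw [log_tilt_shift ht]
  rw [integral_add (((integrable_sq_of_memLp hμ).const_mul _).comp_fst _)
    ((integrable_inner_prod hμ).const_mul _), integral_const_mul (Real.sqrt t),
    integral_inner_prod hμ, integral_fun_fst (fun x : E => t / 2 * ‖x‖ ^ 2), integral_const_mul]
  simp

lemma integrable_tilt_mul_log (hμ : MemLp (fun x => x) 2 μ) {t : ℝ} (ht : 0 ≤ t) :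
    Integrable (fun p : E × E => tilt t p.1 (Real.sqrt t • p.2) *
      Real.log (tilt t p.1 (Real.sqrt t • p.2))) (μ.prod (stdGaussian E)) := by
  have hlog : Measurable fun p : E × E => Real.log (tilt t p.1 (Real.sqrt t • p.2)) :=
    (measurable_tilt_prod t).log
  have h := integrable_log_tilt_shift hμ ht
  have h' : Integrable (fun p : E × E => Real.log (tilt t p.1 (Real.sqrt t • p.2)))
      ((μ.prod (stdGaussian E)).map (fun p => (p.1, Real.sqrt t • p.1 + p.2))) := by
    rw [integrable_map_measure hlog.aestronglyMeasurable (measurable_shift t).aemeasurable]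
    exact h
  rw [map_shift_eq_withDensity ht, integrable_withDensity_iff_integrable_smul'
    (measurable_tilt_prod t).ennreal_ofReal (by simp)] at h'
  simpa only [ENNReal.toReal_ofReal (tilt_pos _ _ _).le, smul_eq_mul] using h'

/-- The integrand of the relative entropy is integrable: by Jensen's inequality it is at most the
prior mean of `tilt * log tilt`. -/
lemma integrable_relEnt [IsProbabilityMeasure μ] (hμ : MemLp (fun x => x) 2 μ) {t : ℝ}
    (ht : 0 ≤ t) :
    Integrable (fun v => evidence μ t (Real.sqrt t • v) *
      Real.log (evidence μ t (Real.sqrt t • v))) (stdGaussian E) := by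
  have h1 := (integrable_tilt_mul_log hμ ht).swap
  have h2 := h1.integral_prod_left
  refine ((integrable_const (1 : ℝ)).add h2.abs).mono'
    (Measurable.aestronglyMeasurable (by fun_prop)) ?_
  filter_upwards [h1.prod_right_ae, ae_integrable_tilt (μ := μ) ht] with v hv hv0
  have hL := evidence_pos hv0
  simp only [Function.comp_apply, Prod.swap_prod_mk] at hv ⊢
  set L := evidence μ t (Real.sqrt t • v) with hLdef
  have hjensen : L * Real.log L ≤ ∫ x, tilt t x (Real.sqrt t • v) *
      Real.log (tilt t x (Real.sqrt t • v)) ∂μ := by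
    have h3 : ∫ x, (tilt t x (Real.sqrt t • v) * (Real.log L + 1) - L) ∂μ ≤
        ∫ x, tilt t x (Real.sqrt t • v) * Real.log (tilt t x (Real.sqrt t • v)) ∂μ := by
      refine integral_mono ((hv0.mul_const _).sub (integrable_const _)) hv fun x => ?_
      have he := tilt_pos t x (Real.sqrt t • v)
      dsimp only
      set e := tilt t x (Real.sqrt t • v)
      have h4 := Real.log_le_sub_one_of_pos (div_pos hL he)
      rw [Real.log_div hL.ne' he.ne'] at h4
      have h5 := mul_le_mul_of_nonneg_left h4 he.le
      have h6 : e * (L / e - 1) = L - e := by field_simp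
      rw [h6] at h5
      linarith
    rw [integral_sub (hv0.mul_const _) (integrable_const _), integral_mul_const] at h3
    change L * _ - _ ≤ _ at h3
    simp only [integral_const, probReal_univ, one_smul] at h3
    linarith
  have hlow : -1 ≤ L * Real.log L := by
    have h2 := Real.one_sub_inv_le_log_of_pos hL
    have := mul_le_mul_of_nonneg_left h2 hL.le
    have h3 : L * (1 - L⁻¹) = L - 1 := by field_simp
    linarith
  have hle := le_abs_self (∫ x, tilt t x (Real.sqrt t • v) *
      Real.log (tilt t x (Real.sqrt t • v)) ∂μ)
  have hnn := abs_nonneg (∫ x, tilt t x (Real.sqrt t • v) *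
      Real.log (tilt t x (Real.sqrt t • v)) ∂μ)
  rw [Real.norm_eq_abs, abs_le]
  constructor
  · simp only [Pi.add_apply]; linarith
  · simp only [Pi.add_apply]; linarith

end JointLaw

section Truncation

variable {E : Type*} [NormedAddCommGroup E] [InnerProductSpace ℝ E] [FiniteDimensional ℝ E]
  [MeasurableSpace E] [BorelSpace E] {μ : Measure E}

/-- The restriction of `μ` to the closed ball of radius `n`. -/
noncomputable def truncate (μ : Measure E) (n : ℕ) : Measure E :=
  μ.restrict (Metric.closedBall 0 n)

instance [IsFiniteMeasure μ] (n : ℕ) : IsFiniteMeasure (truncate μ n) := by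
  unfold truncate; infer_instance

lemma truncate_bounded (μ : Measure E) (n : ℕ) : ∀ᵐ x ∂(truncate μ n), ‖x‖ ≤ n := by
  refine (ae_restrict_mem Metric.isClosed_closedBall.measurableSet).mono fun x hx => ?_
  simpa using hx

lemma tendsto_integral_truncate {F : Type*} [NormedAddCommGroup F] [NormedSpace ℝ F]
    {g : E → F} (hg : Integrable g μ) :
    Filter.Tendsto (fun n => ∫ x, g x ∂(truncate μ n)) Filter.atTop (nhds (∫ x, g x ∂μ)) := by
  have hU : (⋃ n : ℕ, Metric.closedBall (0 : E) n) = Set.univ := Metric.iUnion_closedBall_nat 0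
  have h := tendsto_setIntegral_of_monotone (μ := μ) (f := g)
    (s := fun n : ℕ => Metric.closedBall (0 : E) n)
    (fun n => Metric.isClosed_closedBall.measurableSet)
    (fun i j hij => Metric.closedBall_subset_closedBall (by exact_mod_cast hij))
    (by rw [hU]; exact hg.integrableOn)
  rwa [hU, setIntegral_univ] at h

lemma integral_truncate_le {g : E → ℝ} (hg : Integrable g μ) (h0 : ∀ x, 0 ≤ g x) (n : ℕ) :
    ∫ x, g x ∂(truncate μ n) ≤ ∫ x, g x ∂μ :=
  setIntegral_le_integral hg (Filter.Eventually.of_forall h0)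

lemma abs_mul_log_le_of_le {x y : ℝ} (hx : 0 ≤ x) (hxy : x ≤ y) :
    |x * Real.log x| ≤ 1 + |y * Real.log y| := by
  rcases le_or_gt 1 x with h | h
  · rw [abs_of_nonneg (mul_nonneg hx (Real.log_nonneg h))]
    have : x * Real.log x ≤ y * Real.log y :=
      mul_le_mul hxy (Real.log_le_log (by linarith) hxy) (Real.log_nonneg h) (by linarith)
    have := le_abs_self (y * Real.log y)
    linarith
  · have h1 := abs_nonneg (y * Real.log y)
    rcases hx.eq_or_lt with rfl | h0
    · simp; positivity
    rw [abs_of_nonpos (mul_nonpos_of_nonneg_of_nonpos hx (Real.log_nonpos hx h.le))]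
    have h2 := mul_le_mul_of_nonneg_left (Real.one_sub_inv_le_log_of_pos h0) hx
    have h3 : x * (1 - x⁻¹) = x - 1 := by field_simp
    linarith

variable [IsProbabilityMeasure μ]

lemma tendsto_relEnt_truncate (hμ : MemLp (fun x => x) 2 μ) {t : ℝ} (ht : 0 ≤ t) :
    Filter.Tendsto (fun n => relEnt (truncate μ n) t) Filter.atTop (nhds (relEnt μ t)) := by
  refine tendsto_integral_of_dominated_convergence (fun v => 1 + |evidence μ t (Real.sqrt t • v) *
      Real.log (evidence μ t (Real.sqrt t • v))|)
    (fun n => Measurable.aestronglyMeasurable (by fun_prop))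
    ((integrable_const (1 : ℝ)).add (integrable_relEnt hμ ht).abs) (fun n => ?_) ?_
  · filter_upwards [ae_integrable_tilt (μ := μ) ht] with v hv
    exact abs_mul_log_le_of_le (evidence_nonneg _ _ _)
      (integral_truncate_le hv (fun x => (tilt_pos _ _ _).le) n)
  · filter_upwards [ae_integrable_tilt (μ := μ) ht] with v hv
    exact (Real.continuous_mul_log.tendsto _).comp (tendsto_integral_truncate hv)

lemma tendsto_estEnergy_truncate (hμ : MemLp (fun x => x) 2 μ) {t : ℝ} (ht : 0 ≤ t) :
    Filter.Tendsto (fun n => estEnergy (truncate μ n) t) Filter.atTop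
      (nhds (estEnergy μ t)) := by
  refine tendsto_integral_of_dominated_convergence
    (fun v => ∫ x, tilt t x (Real.sqrt t • v) * ‖x‖ ^ 2 ∂μ)
    (fun n => Measurable.aestronglyMeasurable (by fun_prop))
    (integrable_tilt_smul_prod (integrable_sq_of_memLp hμ) ht).integral_prod_left
    (fun n => ?_) ?_
  · filter_upwards [ae_integrable_tilt (μ := μ) ht,
      ae_integrable_tilt_smul (integrable_of_memLp hμ) ht,
      ae_integrable_tilt_smul (integrable_sq_of_memLp hμ) ht] with v h0 h1 h2
    rw [Real.norm_of_nonneg (div_nonneg (sq_nonneg _) (evidence_nonneg _ _ _))]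
    exact (norm_tiltMean_sq_div_le h0.restrict h1.restrict h2.restrict).trans
      (integral_truncate_le h2 (fun x => mul_nonneg (tilt_pos _ _ _).le (sq_nonneg _)) n)
  · filter_upwards [ae_integrable_tilt (μ := μ) ht,
      ae_integrable_tilt_smul (integrable_of_memLp hμ) ht] with v h0 h1
    exact ((tendsto_integral_truncate h1).norm.pow 2).div (tendsto_integral_truncate h0)
      (evidence_pos h0).ne'

/-- The relative entropy grows at most at the rate given by half the energy of the posterior mean
at the end of the interval. This is the only half of the I-MMSE relation that is needed. -/
theorem relEnt_sub_le (hμ : MemLp (fun x => x) 2 μ) {a b : ℝ} (ha : 0 ≤ a) (hab : a ≤ b) :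
    relEnt μ b - relEnt μ a ≤ (b - a) / 2 * estEnergy μ b :=
  le_of_tendsto_of_tendsto'
    ((tendsto_relEnt_truncate hμ (ha.trans hab)).sub (tendsto_relEnt_truncate hμ ha))
    ((tendsto_estEnergy_truncate hμ (ha.trans hab)).const_mul _)
    fun n => relEnt_sub_le_of_bounded (truncate_bounded μ n) ha hab

end Truncation

/-! ### Divergences of measures with densities, and the channel information -/

section Divergence

/-- The divergence between two probability measures given by densities, as the mean of the log
likelihood ratio. -/
lemma klDiv_withDensity {A : Type*} [MeasurableSpace A] {ν : Measure A} [SigmaFinite ν]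
    {a b : A → ℝ} (ham : Measurable a) (hbm : Measurable b) (ha : ∀ᵐ x ∂ν, 0 < a x)
    (hb : ∀ᵐ x ∂ν, 0 < b x)
    [IsProbabilityMeasure (ν.withDensity fun x => ENNReal.ofReal (a x))]
    [IsProbabilityMeasure (ν.withDensity fun x => ENNReal.ofReal (b x))]
    (hint : Integrable (fun x => Real.log (a x) - Real.log (b x))
      (ν.withDensity fun x => ENNReal.ofReal (a x))) :
    klDiv (ν.withDensity fun x => ENNReal.ofReal (a x))
        (ν.withDensity fun x => ENNReal.ofReal (b x)) ≠ ∞ ∧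
      (klDiv (ν.withDensity fun x => ENNReal.ofReal (a x))
        (ν.withDensity fun x => ENNReal.ofReal (b x))).toReal =
      ∫ x, (Real.log (a x) - Real.log (b x)) ∂(ν.withDensity fun x => ENNReal.ofReal (a x)) := by
  set α := ν.withDensity fun x => ENNReal.ofReal (a x) with hα
  set β := ν.withDensity fun x => ENNReal.ofReal (b x) with hβ
  have hαν : α ≪ ν := withDensity_absolutelyContinuous _ _
  have hdens : α = β.withDensity fun x => ENNReal.ofReal (a x / b x) := by
    have hm : Measurable fun x => ENNReal.ofReal (a x / b x) := (ham.div hbm).ennreal_ofReal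
    rw [hβ, ← withDensity_mul _ hbm.ennreal_ofReal hm, hα]
    refine withDensity_congr_ae ?_
    filter_upwards [ha, hb] with x h1 h2
    rw [Pi.mul_apply, ← ENNReal.ofReal_mul h2.le, mul_div_cancel₀ _ h2.ne']
  have hac : α ≪ β := by rw [hdens]; exact withDensity_absolutelyContinuous _ _
  have hllr : llr α β =ᵐ[α] fun x => Real.log (a x) - Real.log (b x) := by
    have h1 : α.rnDeriv β =ᵐ[β] fun x => ENNReal.ofReal (a x / b x) := by
      rw [hdens]
      exact Measure.rnDeriv_withDensity _ (ham.div hbm).ennreal_ofReal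
    filter_upwards [hac.ae_le h1, hαν.ae_le ha, hαν.ae_le hb] with x h h2 h3
    rw [llr, h, ENNReal.toReal_ofReal (div_pos h2 h3).le, Real.log_div h2.ne' h3.ne']
  have hint' : Integrable (llr α β) α := hint.congr hllr.symm
  refine ⟨klDiv_ne_top hac hint', ?_⟩
  rw [toReal_klDiv_of_measure_eq hac (by simp), integral_congr_ae hllr]

end Divergence

section Channel

variable {E : Type*} [NormedAddCommGroup E] [InnerProductSpace ℝ E] [FiniteDimensional ℝ E]
  [MeasurableSpace E] [BorelSpace E] {μ : Measure E} [IsProbabilityMeasure μ]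

lemma lintegral_tilt_eq {t : ℝ} {y : E} (h : Integrable (fun x => tilt t x y) μ) :
    ∫⁻ x, ENNReal.ofReal (tilt t x y) ∂μ = ENNReal.ofReal (evidence μ t y) := by
  rw [evidence, ofReal_integral_eq_lintegral_ofReal h
    (Filter.Eventually.of_forall fun x => (tilt_pos _ _ _).le)]

lemma lintegral_tilt_mul_prod {t : ℝ} (ht : 0 ≤ t) {F : E → ℝ≥0∞} (hF : Measurable F) :
    ∫⁻ p, ENNReal.ofReal (tilt t p.1 (Real.sqrt t • p.2)) * F p.2 ∂(μ.prod (stdGaussian E)) =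
      ∫⁻ v, ENNReal.ofReal (evidence μ t (Real.sqrt t • v)) * F v ∂(stdGaussian E) := by
  have hm : Measurable fun p : E × E =>
      ENNReal.ofReal (tilt t p.1 (Real.sqrt t • p.2)) * F p.2 :=
    (measurable_tilt_prod t).ennreal_ofReal.mul (hF.comp measurable_snd)
  rw [lintegral_prod_symm _ hm.aemeasurable]
  refine lintegral_congr_ae ?_
  filter_upwards [ae_integrable_tilt (μ := μ) ht] with v hv
  rw [lintegral_mul_const _ (measurable_tilt_left t _).ennreal_ofReal, lintegral_tilt_eq hv]

/-- The law of the normalized observation `√t X + N` has density `evidence` with respect to pure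
noise. -/
lemma map_observation_eq_withDensity {t : ℝ} (ht : 0 ≤ t) :
    (μ.prod (stdGaussian E)).map (fun p => Real.sqrt t • p.1 + p.2) =
      (stdGaussian E).withDensity
        (fun v => ENNReal.ofReal (evidence μ t (Real.sqrt t • v))) := by
  have h : (μ.prod (stdGaussian E)).map (fun p => Real.sqrt t • p.1 + p.2) =
      ((μ.prod (stdGaussian E)).map (fun p => (p.1, Real.sqrt t • p.1 + p.2))).map Prod.snd := by
    rw [Measure.map_map measurable_snd (measurable_shift t)]; rfl
  rw [h, map_shift_eq_withDensity ht]
  refine Measure.ext_of_lintegral _ fun F hF => ?_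
  have hm : Measurable fun v : E => ENNReal.ofReal (evidence μ t (Real.sqrt t • v)) := by fun_prop
  rw [lintegral_map hF measurable_snd, lintegral_withDensity_eq_lintegral_mul _
    (measurable_tilt_prod t).ennreal_ofReal (by fun_prop : Measurable fun p : E × E => F p.2),
    lintegral_withDensity_eq_lintegral_mul _ hm hF]
  exact lintegral_tilt_mul_prod ht hF

lemma integrable_observation_iff {F : Type*} [NormedAddCommGroup F] [NormedSpace ℝ F] {g : E → F}
    (hg : StronglyMeasurable g) {t : ℝ} (ht : 0 ≤ t) :
    Integrable (fun p : E × E => g (Real.sqrt t • p.1 + p.2)) (μ.prod (stdGaussian E)) ↔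
      Integrable (fun v => evidence μ t (Real.sqrt t • v) • g v) (stdGaussian E) := by
  have hm : Measurable fun v : E => ENNReal.ofReal (evidence μ t (Real.sqrt t • v)) := by fun_prop
  have h := integrable_map_measure (μ := μ.prod (stdGaussian E))
    (f := fun p : E × E => Real.sqrt t • p.1 + p.2) hg.aestronglyMeasurable (by fun_prop)
  rw [map_observation_eq_withDensity ht,
    integrable_withDensity_iff_integrable_smul' hm (by simp)] at h
  simp only [ENNReal.toReal_ofReal (evidence_nonneg _ _ _)] at h
  exact h.symm

lemma integral_observation {F : Type*} [NormedAddCommGroup F] [NormedSpace ℝ F] {g : E → F}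
    (hg : StronglyMeasurable g) {t : ℝ} (ht : 0 ≤ t) :
    ∫ p : E × E, g (Real.sqrt t • p.1 + p.2) ∂(μ.prod (stdGaussian E)) =
      ∫ v, evidence μ t (Real.sqrt t • v) • g v ∂(stdGaussian E) := by
  have hm : Measurable fun v : E => ENNReal.ofReal (evidence μ t (Real.sqrt t • v)) := by fun_prop
  rw [← integral_map (φ := fun p : E × E => Real.sqrt t • p.1 + p.2) (by fun_prop)
    hg.aestronglyMeasurable, map_observation_eq_withDensity ht,
    integral_withDensity_eq_integral_toReal_smul hm (by simp)]
  simp only [ENNReal.toReal_ofReal (evidence_nonneg _ _ _)]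

lemma integrable_log_evidence (hμ : MemLp (fun x => x) 2 μ) {t : ℝ} (ht : 0 ≤ t) :
    Integrable (fun p : E × E =>
      Real.log (evidence μ t (Real.sqrt t • (Real.sqrt t • p.1 + p.2))))
      (μ.prod (stdGaussian E)) := by
  have hm : Measurable fun v : E => Real.log (evidence μ t (Real.sqrt t • v)) := by fun_prop
  exact (integrable_observation_iff hm.stronglyMeasurable ht).2 (integrable_relEnt hμ ht)

lemma integral_log_evidence {t : ℝ} (ht : 0 ≤ t) :
    ∫ p : E × E, Real.log (evidence μ t (Real.sqrt t • (Real.sqrt t • p.1 + p.2)))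
      ∂(μ.prod (stdGaussian E)) = relEnt μ t := by
  have hm : Measurable fun v : E => Real.log (evidence μ t (Real.sqrt t • v)) := by fun_prop
  exact integral_observation hm.stronglyMeasurable ht

end Channel

section Info

variable {d : ℕ} {μ : Measure (EuclideanSpace ℝ (Fin d))} [IsProbabilityMeasure μ]

/-- The information of the channel is half the signal energy times `t`, minus the relative entropy
of the observation from pure noise. -/
theorem channelInfo_eq (hμ : MemLp (fun x => x) 2 μ) {t : ℝ} (ht : 0 ≤ t) :
    channelInfo μ t ≠ ∞ ∧
      (channelInfo μ t).toReal = t / 2 * ∫ x, ‖x‖ ^ 2 ∂μ - relEnt μ t := by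
  set γ := stdGaussian (EuclideanSpace ℝ (Fin d)) with hγ
  have hb : Measurable fun v : EuclideanSpace ℝ (Fin d) => evidence μ t (Real.sqrt t • v) := by
    fun_prop
  have e1 : (pairLaw μ).map (fun p => (p.1, channel t p)) =
      (μ.prod γ).withDensity fun p => ENNReal.ofReal (tilt t p.1 (Real.sqrt t • p.2)) :=
    map_shift_eq_withDensity ht
  have e2 : ((pairLaw μ).map Prod.fst).prod ((pairLaw μ).map (channel t)) =
      (μ.prod γ).withDensity fun p => ENNReal.ofReal (evidence μ t (Real.sqrt t • p.2)) := by
    have h1 : (pairLaw μ).map Prod.fst = μ := by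
      have : (pairLaw μ).map Prod.fst = (μ.prod γ).map Prod.fst := rfl
      rw [this, Measure.map_fst_prod]; simp
    have h2 : (pairLaw μ).map (channel t) =
        γ.withDensity fun v => ENNReal.ofReal (evidence μ t (Real.sqrt t • v)) :=
      map_observation_eq_withDensity ht
    rw [h1, h2, prod_withDensity_right hb.ennreal_ofReal]
  have i1 : IsProbabilityMeasure ((μ.prod γ).withDensity fun p =>
      ENNReal.ofReal (tilt t p.1 (Real.sqrt t • p.2))) := by
    rw [← map_shift_eq_withDensity ht]
    exact Measure.isProbabilityMeasure_map (measurable_shift t).aemeasurable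
  have i2 : IsProbabilityMeasure ((μ.prod γ).withDensity fun p =>
      ENNReal.ofReal (evidence μ t (Real.sqrt t • p.2))) := by
    have h2 : IsProbabilityMeasure
        (γ.withDensity fun v => ENNReal.ofReal (evidence μ t (Real.sqrt t • v))) := by
      rw [← map_observation_eq_withDensity ht]
      exact Measure.isProbabilityMeasure_map (by fun_prop)
    rw [← prod_withDensity_right hb.ennreal_ofReal]
    infer_instance
  have hb' : Measurable fun p : EuclideanSpace ℝ (Fin d) × EuclideanSpace ℝ (Fin d) =>
      evidence μ t (Real.sqrt t • p.2) := hb.comp measurable_snd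
  have hla : Measurable fun p : EuclideanSpace ℝ (Fin d) × EuclideanSpace ℝ (Fin d) =>
      Real.log (tilt t p.1 (Real.sqrt t • p.2)) - Real.log (evidence μ t (Real.sqrt t • p.2)) :=
    (measurable_tilt_prod t).log.sub hb'.log
  have h1 := integrable_log_tilt_shift hμ ht
  have h2 := integrable_log_evidence hμ ht
  have hint : Integrable (fun p : EuclideanSpace ℝ (Fin d) × EuclideanSpace ℝ (Fin d) =>
      Real.log (tilt t p.1 (Real.sqrt t • p.2)) - Real.log (evidence μ t (Real.sqrt t • p.2)))
      ((μ.prod γ).withDensity fun p => ENNReal.ofReal (tilt t p.1 (Real.sqrt t • p.2))) := by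
    rw [← map_shift_eq_withDensity ht, integrable_map_measure hla.aestronglyMeasurable
      (measurable_shift t).aemeasurable]
    exact h1.sub h2
  have hpos : ∀ᵐ p ∂(μ.prod γ), 0 < evidence μ t (Real.sqrt t • p.2) := by
    filter_upwards [Measure.quasiMeasurePreserving_snd.ae (ae_integrable_tilt (μ := μ) ht)]
      with p hp using evidence_pos hp
  have key := klDiv_withDensity (measurable_tilt_prod t) hb'
    (Filter.Eventually.of_forall fun p => tilt_pos _ _ _) hpos hint
  unfold channelInfo mutualInfo
  rw [e1, e2]
  refine ⟨key.1, key.2.trans ?_⟩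
  rw [← map_shift_eq_withDensity ht, integral_map (measurable_shift t).aemeasurable
    hla.aestronglyMeasurable, ← integral_log_tilt_shift hμ ht, ← integral_log_evidence ht]
  exact integral_sub h1 h2

end Info

/-! ### The posterior mean and the minimum mean square error -/

section Posterior

lemma integrable_inner_of_memLp {A V : Type*} [MeasurableSpace A] [NormedAddCommGroup V]
    [InnerProductSpace ℝ V] {ν : Measure A} {f g : A → V} (hf : MemLp f 2 ν) (hg : MemLp g 2 ν) :
    Integrable (fun a => (inner ℝ (f a) (g a) : ℝ)) ν :=
  (hf.norm.integrable_mul hg.norm).mono' (hf.1.inner hg.1)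
    (Filter.Eventually.of_forall fun _ => abs_real_inner_le_norm _ _)

variable {E : Type*} [NormedAddCommGroup E] [InnerProductSpace ℝ E] [FiniteDimensional ℝ E]
  [MeasurableSpace E] [BorelSpace E] {μ : Measure E} [IsProbabilityMeasure μ]

/-- The posterior mean of a signal of law `μ` given the observation `y` at time `t`. -/
noncomputable def posteriorMean (μ : Measure E) (t : ℝ) (y : E) : E :=
  (evidence μ t y)⁻¹ • tiltMean μ t y

@[fun_prop]
lemma measurable_posteriorMean (t : ℝ) : Measurable (posteriorMean μ t) := by
  unfold posteriorMean; fun_prop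

lemma evidence_mul_norm_posteriorMean_sq (t : ℝ) (y : E) :
    evidence μ t y * ‖posteriorMean μ t y‖ ^ 2 = ‖tiltMean μ t y‖ ^ 2 / evidence μ t y := by
  rw [posteriorMean, norm_smul, mul_pow, norm_inv, Real.norm_of_nonneg (evidence_nonneg _ _ _)]
  rcases (evidence_nonneg μ t y).eq_or_lt with h | h
  · simp [← h]
  · field_simp

lemma ae_evidence_smul_posteriorMean {t : ℝ} (ht : 0 ≤ t) :
    ∀ᵐ v ∂(stdGaussian E), evidence μ t (Real.sqrt t • v) • posteriorMean μ t (Real.sqrt t • v) =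
      tiltMean μ t (Real.sqrt t • v) := by
  filter_upwards [ae_integrable_tilt (μ := μ) ht] with v hv
  rw [posteriorMean, smul_inv_smul₀ (evidence_pos hv).ne']

variable {Ω : Type*} [MeasurableSpace Ω] {P : Measure Ω} [IsProbabilityMeasure P] {X Y : Ω → E}
  {t : ℝ}

/-- `(X, Y)` has the joint law of a signal of law `μ` and its observation `t X + √t N` at
time `t`. -/
def IsObservation (P : Measure Ω) (μ : Measure E) (t : ℝ) (X Y : Ω → E) : Prop :=
  P.map (fun ω => (X ω, Y ω)) =
    (μ.prod (stdGaussian E)).map (fun p => (p.1, Real.sqrt t • (Real.sqrt t • p.1 + p.2)))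

lemma IsObservation.map_fst (h : IsObservation P μ t X Y) (hX : Measurable X) (hY : Measurable Y) :
    P.map X = μ := by
  have h1 : P.map X = (P.map (fun ω => (X ω, Y ω))).map Prod.fst := by
    rw [Measure.map_map measurable_fst (hX.prodMk hY)]; rfl
  have h2 : (μ.prod (stdGaussian E)).map Prod.fst = μ := by rw [Measure.map_fst_prod]; simp
  rw [h1, h, Measure.map_map measurable_fst (by fun_prop)]
  exact h2

lemma IsObservation.memLp (h : IsObservation P μ t X Y) (hX : Measurable X) (hY : Measurable Y)
    (hμ : MemLp (fun x => x) 2 μ) : MemLp X 2 P := by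
  rw [← h.map_fst hX hY] at hμ
  exact (memLp_map_measure_iff (by fun_prop) hX.aemeasurable).1 hμ

lemma IsObservation.integrable_iff (h : IsObservation P μ t X Y) (hX : Measurable X)
    (hY : Measurable Y) (ht : 0 ≤ t) {F : Type*} [NormedAddCommGroup F] [NormedSpace ℝ F]
    {G : E × E → F} (hG : StronglyMeasurable G) :
    Integrable (fun ω => G (X ω, Y ω)) P ↔
      Integrable (fun p : E × E => tilt t p.1 (Real.sqrt t • p.2) • G (p.1, Real.sqrt t • p.2))
        (μ.prod (stdGaussian E)) := by
  have hm : Measurable fun p : E × E => (p.1, Real.sqrt t • p.2) := by fun_prop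
  have h1 := integrable_map_measure (μ := P) (f := fun ω => (X ω, Y ω)) (g := G)
    hG.aestronglyMeasurable (hX.prodMk hY).aemeasurable
  have h2 : (μ.prod (stdGaussian E)).map
      (fun p => (p.1, Real.sqrt t • (Real.sqrt t • p.1 + p.2))) =
      ((μ.prod (stdGaussian E)).withDensity
        (fun p => ENNReal.ofReal (tilt t p.1 (Real.sqrt t • p.2)))).map
        (fun p => (p.1, Real.sqrt t • p.2)) := by
    rw [← map_shift_eq_withDensity ht, Measure.map_map hm (measurable_shift t)]; rfl
  rw [h, h2, integrable_map_measure hG.aestronglyMeasurable hm.aemeasurable,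
    integrable_withDensity_iff_integrable_smul' (measurable_tilt_prod t).ennreal_ofReal
      (by simp)] at h1
  simp only [ENNReal.toReal_ofReal (tilt_pos _ _ _).le] at h1
  exact h1.symm

lemma IsObservation.integral_eq (h : IsObservation P μ t X Y) (hX : Measurable X)
    (hY : Measurable Y) (ht : 0 ≤ t) {F : Type*} [NormedAddCommGroup F] [NormedSpace ℝ F]
    {G : E × E → F} (hG : StronglyMeasurable G) :
    ∫ ω, G (X ω, Y ω) ∂P =
      ∫ p : E × E, tilt t p.1 (Real.sqrt t • p.2) • G (p.1, Real.sqrt t • p.2)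
        ∂(μ.prod (stdGaussian E)) := by
  have hm : Measurable fun p : E × E => (p.1, Real.sqrt t • p.2) := by fun_prop
  have h2 : (μ.prod (stdGaussian E)).map
      (fun p => (p.1, Real.sqrt t • (Real.sqrt t • p.1 + p.2))) =
      ((μ.prod (stdGaussian E)).withDensity
        (fun p => ENNReal.ofReal (tilt t p.1 (Real.sqrt t • p.2)))).map
        (fun p => (p.1, Real.sqrt t • p.2)) := by
    rw [← map_shift_eq_withDensity ht, Measure.map_map hm (measurable_shift t)]; rfl
  rw [← integral_map (φ := fun ω => (X ω, Y ω)) (hX.prodMk hY).aemeasurable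
    hG.aestronglyMeasurable, h, h2, integral_map hm.aemeasurable hG.aestronglyMeasurable,
    integral_withDensity_eq_integral_toReal_smul (measurable_tilt_prod t).ennreal_ofReal
      (by simp)]
  simp only [ENNReal.toReal_ofReal (tilt_pos _ _ _).le]

lemma IsObservation.integrable_right_iff (h : IsObservation P μ t X Y) (hX : Measurable X)
    (hY : Measurable Y) (ht : 0 ≤ t) {F : Type*} [NormedAddCommGroup F] [NormedSpace ℝ F]
    {g : E → F} (hg : StronglyMeasurable g) :
    Integrable (fun ω => g (Y ω)) P ↔
      Integrable (fun v => evidence μ t (Real.sqrt t • v) • g (Real.sqrt t • v))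
        (stdGaussian E) := by
  rw [← integrable_observation_iff (g := fun v => g (Real.sqrt t • v))
    (hg.comp_measurable (by fun_prop)) ht]
  have h1 := integrable_map_measure (μ := P) (f := fun ω => (X ω, Y ω)) (g := fun p => g p.2)
    (hg.comp_measurable measurable_snd).aestronglyMeasurable (hX.prodMk hY).aemeasurable
  have hg2 : StronglyMeasurable fun p : E × E => g p.2 := hg.comp_measurable measurable_snd
  rw [h, integrable_map_measure hg2.aestronglyMeasurable (by fun_prop)] at h1
  exact h1.symm

lemma IsObservation.integral_right_eq (h : IsObservation P μ t X Y) (hX : Measurable X)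
    (hY : Measurable Y) (ht : 0 ≤ t) {F : Type*} [NormedAddCommGroup F] [NormedSpace ℝ F]
    {g : E → F} (hg : StronglyMeasurable g) :
    ∫ ω, g (Y ω) ∂P =
      ∫ v, evidence μ t (Real.sqrt t • v) • g (Real.sqrt t • v) ∂(stdGaussian E) := by
  have hg2 : StronglyMeasurable fun p : E × E => g p.2 := hg.comp_measurable measurable_snd
  rw [← integral_observation (g := fun v => g (Real.sqrt t • v))
    (hg.comp_measurable (by fun_prop)) ht,
    ← integral_map (φ := fun ω => (X ω, Y ω)) (f := fun p => g p.2)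
      (hX.prodMk hY).aemeasurable hg2.aestronglyMeasurable, h,
    integral_map (by fun_prop) hg2.aestronglyMeasurable]

lemma IsObservation.memLp_posteriorMean (h : IsObservation P μ t X Y) (hX : Measurable X)
    (hY : Measurable Y) (ht : 0 ≤ t) (hμ : MemLp (fun x => x) 2 μ) :
    MemLp (fun ω => posteriorMean μ t (Y ω)) 2 P := by
  have hm : Measurable fun ω => posteriorMean μ t (Y ω) :=
    (measurable_posteriorMean t).comp hY
  rw [memLp_two_iff_integrable_sq_norm hm.aestronglyMeasurable,
    h.integrable_right_iff (g := fun y => ‖posteriorMean μ t y‖ ^ 2) hX hY ht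
      (Measurable.stronglyMeasurable (by fun_prop))]
  simp_rw [smul_eq_mul, evidence_mul_norm_posteriorMean_sq]
  exact integrable_estEnergy hμ ht

lemma IsObservation.integral_norm_posteriorMean_sq (h : IsObservation P μ t X Y)
    (hX : Measurable X) (hY : Measurable Y) (ht : 0 ≤ t) :
    ∫ ω, ‖posteriorMean μ t (Y ω)‖ ^ 2 ∂P = estEnergy μ t := by
  rw [h.integral_right_eq (g := fun y => ‖posteriorMean μ t y‖ ^ 2) hX hY ht
      (Measurable.stronglyMeasurable (by fun_prop))]
  simp_rw [smul_eq_mul, evidence_mul_norm_posteriorMean_sq]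
  rfl

lemma IsObservation.integral_inner_posteriorMean (h : IsObservation P μ t X Y)
    (hX : Measurable X) (hY : Measurable Y) (ht : 0 ≤ t) (hμ : MemLp (fun x => x) 2 μ) :
    ∫ ω, (inner ℝ (X ω) (posteriorMean μ t (Y ω)) : ℝ) ∂P = estEnergy μ t := by
  have hm : StronglyMeasurable fun p : E × E => (inner ℝ p.1 (posteriorMean μ t p.2) : ℝ) :=
    Measurable.stronglyMeasurable (by fun_prop)
  have hi : Integrable (fun ω => (inner ℝ (X ω) (posteriorMean μ t (Y ω)) : ℝ)) P :=
    integrable_inner_of_memLp (h.memLp hX hY hμ) (h.memLp_posteriorMean hX hY ht hμ)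
  have hi2 := (h.integrable_iff (G := fun p => (inner ℝ p.1 (posteriorMean μ t p.2) : ℝ))
    hX hY ht hm).1 hi
  rw [h.integral_eq (G := fun p => (inner ℝ p.1 (posteriorMean μ t p.2) : ℝ)) hX hY ht hm,
    integral_prod_symm _ hi2]
  refine integral_congr_ae ?_
  filter_upwards [ae_integrable_tilt_smul (integrable_of_memLp hμ) ht] with v hv
  have e : ∀ x : E, tilt t x (Real.sqrt t • v) •
      (inner ℝ x (posteriorMean μ t (Real.sqrt t • v)) : ℝ) =
      inner ℝ (posteriorMean μ t (Real.sqrt t • v)) (tilt t x (Real.sqrt t • v) • x) := fun x => by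
    rw [inner_smul_right, real_inner_comm, smul_eq_mul]
  simp_rw [e]
  rw [integral_inner hv]
  change inner ℝ (posteriorMean μ t (Real.sqrt t • v)) (tiltMean μ t (Real.sqrt t • v)) = _
  rw [posteriorMean, inner_smul_left, real_inner_self_eq_norm_sq, div_eq_inv_mul]
  simp

/-- **Bayes' formula**: the conditional expectation of the signal given the observation is the
posterior mean. -/
theorem IsObservation.condExp_eq (h : IsObservation P μ t X Y)
    (hX : Measurable X) (hY : Measurable Y) (ht : 0 ≤ t) (hμ : MemLp (fun x => x) 2 μ) :
    P[X | MeasurableSpace.comap Y inferInstance] =ᵐ[P] fun ω => posteriorMean μ t (Y ω) := by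
  have hXi : Integrable X P := (h.memLp hX hY hμ).integrable (by norm_num)
  have hmi : Integrable (fun ω => posteriorMean μ t (Y ω)) P :=
    (h.memLp_posteriorMean hX hY ht hμ).integrable (by norm_num)
  refine (ae_eq_condExp_of_forall_setIntegral_eq hY.comap_le hXi (fun s _ _ => hmi.integrableOn)
    ?_ ?_).symm
  · rintro s ⟨A, hA, rfl⟩ -
    have hs : MeasurableSet (Y ⁻¹' A) := hY hA
    have e1 : ∀ (g : Ω → E) (G : E × E → E), (∀ ω, g ω = G (X ω, Y ω)) →
        ∫ ω in Y ⁻¹' A, g ω ∂P =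
          ∫ ω, (fun p : E × E => A.indicator (fun _ => (1 : ℝ)) p.2 • G p) (X ω, Y ω) ∂P := by
      intro g G hg
      rw [← integral_indicator hs]
      refine integral_congr_ae (Filter.Eventually.of_forall fun ω => ?_)
      by_cases hω : Y ω ∈ A <;> simp [Set.indicator, hω, hg]
    have hind : Measurable fun p : E × E => A.indicator (fun _ => (1 : ℝ)) p.2 :=
      (measurable_const.indicator hA).comp measurable_snd
    rw [e1 (fun ω => posteriorMean μ t (Y ω)) (fun p => posteriorMean μ t p.2) (fun _ => rfl),
      e1 X (fun p => p.1) (fun _ => rfl)]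
    have hG1 : StronglyMeasurable fun p : E × E =>
        A.indicator (fun _ => (1 : ℝ)) p.2 • posteriorMean μ t p.2 :=
      Measurable.stronglyMeasurable (by fun_prop)
    have hG2 : StronglyMeasurable fun p : E × E => A.indicator (fun _ => (1 : ℝ)) p.2 • p.1 :=
      Measurable.stronglyMeasurable (by fun_prop)
    have hbd : ∀ y : E, ‖A.indicator (fun _ => (1 : ℝ)) y‖ ≤ 1 := fun y => by
      by_cases hy : y ∈ A <;> simp [hy]
    have hI1 : Integrable (fun ω => A.indicator (fun _ => (1 : ℝ)) (Y ω) •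
        posteriorMean μ t (Y ω)) P :=
      hmi.bdd_smul 1 ((measurable_const.indicator hA).comp hY).aestronglyMeasurable
        (Filter.Eventually.of_forall fun ω => hbd _)
    have hI2 : Integrable (fun ω => A.indicator (fun _ => (1 : ℝ)) (Y ω) • X ω) P :=
      hXi.bdd_smul 1 ((measurable_const.indicator hA).comp hY).aestronglyMeasurable
        (Filter.Eventually.of_forall fun ω => hbd _)
    have hJ1 := (h.integrable_iff hX hY ht hG1).1 hI1
    have hJ2 := (h.integrable_iff hX hY ht hG2).1 hI2
    rw [h.integral_eq hX hY ht hG1, h.integral_eq hX hY ht hG2, integral_prod_symm _ hJ1,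
      integral_prod_symm _ hJ2]
    refine integral_congr_ae ?_
    filter_upwards [ae_evidence_smul_posteriorMean (μ := μ) ht] with v hv
    rw [integral_smul_const, smul_comm]
    simp_rw [smul_comm (tilt t _ (Real.sqrt t • v))]
    rw [integral_smul]
    change _ • evidence μ t _ • _ = _ • tiltMean μ t _
    rw [hv]
  · exact ((measurable_posteriorMean t).comp
      (comap_measurable Y)).stronglyMeasurable.aestronglyMeasurable

end Posterior

section MMSE

variable {E : Type*} [NormedAddCommGroup E] [InnerProductSpace ℝ E] [FiniteDimensional ℝ E]
  [MeasurableSpace E] [BorelSpace E] {μ : Measure E} [IsProbabilityMeasure μ]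
  {Ω : Type*} [MeasurableSpace Ω] {P : Measure Ω} [IsProbabilityMeasure P] {X Y : Ω → E} {t : ℝ}

lemma IsObservation.integral_norm_sub_sq (h : IsObservation P μ t X Y)
    (hX : Measurable X) (hY : Measurable Y) (ht : 0 ≤ t) (hμ : MemLp (fun x => x) 2 μ) :
    ∫ ω, ‖X ω - posteriorMean μ t (Y ω)‖ ^ 2 ∂P = ∫ x, ‖x‖ ^ 2 ∂μ - estEnergy μ t := by
  have h1 := h.memLp hX hY hμ
  have h2 := h.memLp_posteriorMean hX hY ht hμ
  have i1 : Integrable (fun ω => ‖X ω‖ ^ 2) P := (memLp_two_iff_integrable_sq_norm h1.1).1 h1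
  have i2 : Integrable (fun ω => ‖posteriorMean μ t (Y ω)‖ ^ 2) P :=
    (memLp_two_iff_integrable_sq_norm h2.1).1 h2
  have i3 : Integrable (fun ω => (inner ℝ (X ω) (posteriorMean μ t (Y ω)) : ℝ)) P :=
    integrable_inner_of_memLp h1 h2
  have i4 : Integrable
      (fun ω => ‖X ω‖ ^ 2 - 2 * inner ℝ (X ω) (posteriorMean μ t (Y ω))) P :=
    i1.sub (i3.const_mul 2)
  simp_rw [norm_sub_sq_real]
  rw [integral_add i4 i2, integral_sub i1 (i3.const_mul 2), integral_const_mul,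
    h.integral_inner_posteriorMean hX hY ht hμ, h.integral_norm_posteriorMean_sq hX hY ht,
    ← h.map_fst hX hY, integral_map hX.aemeasurable (by fun_prop)]
  ring

end MMSE

section ChannelMMSE

variable {d : ℕ} {μ : Measure (EuclideanSpace ℝ (Fin d))} [IsProbabilityMeasure μ]

instance : IsProbabilityMeasure (pairLaw μ) := by unfold pairLaw; infer_instance

lemma measurable_channel (s : ℝ) : Measurable (channel (d := d) s) := by
  unfold channel; fun_prop

lemma isObservation_channel (s : ℝ) :
    IsObservation (pairLaw μ) μ s Prod.fst (fun p => Real.sqrt s • channel s p) := rfl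

lemma condExp_channel (hμ : MemLp (fun x => x) 2 μ) {s : ℝ} (hs : 0 ≤ s) :
    (pairLaw μ)[Prod.fst | MeasurableSpace.comap (channel s) inferInstance] =ᵐ[pairLaw μ]
      fun p => posteriorMean μ s (Real.sqrt s • channel s p) := by
  have hm := measurable_channel (d := d) s
  have hY : Measurable fun p => Real.sqrt s • channel (d := d) s p := by fun_prop
  rcases hs.eq_or_lt with rfl | hs'
  · -- At time zero the channel output is pure noise, so conditioning on it is void.
    have hc : ∀ p, channel (d := d) 0 p = p.2 := fun p => by simp [channel]
    have hind : Indep (MeasurableSpace.comap Prod.fst inferInstance)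
        (MeasurableSpace.comap (channel (d := d) 0) inferInstance) (pairLaw μ) := by
      have h1 : IndepFun (fun p : EuclideanSpace ℝ (Fin d) × EuclideanSpace ℝ (Fin d) => p.1)
          (fun p => p.2) (pairLaw μ) := indepFun_prod measurable_id measurable_id
      have h2 : channel (d := d) 0 = fun p => p.2 := funext hc
      rw [h2]
      exact h1
    refine (condExp_indep_eq measurable_fst.comap_le hm.comap_le
      (comap_measurable Prod.fst).stronglyMeasurable hind).trans ?_
    refine Filter.Eventually.of_forall fun p => ?_
    have h1 : ∫ p, p.1 ∂(pairLaw μ) = ∫ x, x ∂μ := by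
      unfold pairLaw
      rw [integral_fun_fst (fun x : EuclideanSpace ℝ (Fin d) => x)]; simp
    simp [posteriorMean, evidence_zero, tiltMean_zero, h1]
  · have h1 := (isObservation_channel (μ := μ) s).condExp_eq measurable_fst hY hs hμ
    have h2 : MeasurableSpace.comap (fun p => Real.sqrt s • channel (d := d) s p) inferInstance =
        MeasurableSpace.comap (channel (d := d) s) inferInstance := by
      have h3 : (fun p => Real.sqrt s • channel (d := d) s p) =
          (MeasurableEquiv.smul₀ (Real.sqrt s) (Real.sqrt_pos.2 hs').ne') ∘ channel (d := d) s :=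
        rfl
      rw [h3, ← MeasurableSpace.comap_comp, (MeasurableEquiv.measurableEmbedding _).comap_eq]
    rw [h2] at h1
    exact h1

theorem mmse_eq (hμ : MemLp (fun x => x) 2 μ) {s : ℝ} (hs : 0 ≤ s) :
    mmse μ s = ∫ x, ‖x‖ ^ 2 ∂μ - estEnergy μ s := by
  have hm := measurable_channel (d := d) s
  have hY : Measurable fun p => Real.sqrt s • channel (d := d) s p := by fun_prop
  rw [← (isObservation_channel (μ := μ) s).integral_norm_sub_sq measurable_fst hY hs hμ, mmse]
  refine integral_congr_ae ?_
  filter_upwards [condExp_channel hμ hs] with p hp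
  rw [hp]

end ChannelMMSE

/-! ### Noise walks and Girsanov's formula -/

section Noise

variable {E : Type*} [NormedAddCommGroup E] [InnerProductSpace ℝ E] [FiniteDimensional ℝ E]
  [MeasurableSpace E] [BorelSpace E] {Ω : Type*} [MeasurableSpace Ω]

/-- `N` is a sequence of independent standard Gaussian vectors. -/
structure IsGaussianNoise (P : Measure Ω) (N : ℕ → Ω → E) : Prop where
  measurable : ∀ k, Measurable (N k)
  law : ∀ k, P.map (N k) = stdGaussian E
  indep : iIndepFun N P

/-- The time reached after `k` steps of the sizes `δ 1, …, δ k`. -/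
def elapsed (δ : ℕ → ℝ) (k : ℕ) : ℝ := ∑ i ∈ Finset.range k, δ (i + 1)

lemma elapsed_zero (δ : ℕ → ℝ) : elapsed δ 0 = 0 := by simp [elapsed]

lemma elapsed_succ (δ : ℕ → ℝ) (k : ℕ) : elapsed δ (k + 1) = elapsed δ k + δ (k + 1) := by
  simp [elapsed, Finset.sum_range_succ]

lemma elapsed_nonneg {δ : ℕ → ℝ} (hδ : ∀ k, 0 ≤ δ k) (k : ℕ) : 0 ≤ elapsed δ k :=
  Finset.sum_nonneg fun _ _ => hδ _

/-- The driftless process: the sums of the scaled noise increments. -/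
noncomputable def noiseWalk (δ : ℕ → ℝ) (N : ℕ → Ω → E) : ℕ → Ω → E :=
  samplingProcess δ (fun _ _ => 0) N

lemma noiseWalk_succ (δ : ℕ → ℝ) (N : ℕ → Ω → E) (k : ℕ) (ω : Ω) :
    noiseWalk δ N (k + 1) ω = noiseWalk δ N k ω + Real.sqrt (δ (k + 1)) • N (k + 1) ω := by
  simp [noiseWalk, samplingProcess]

/-- Given the signal, the comparison process is a sampling process of constant drift. -/
lemma compProcess_eq_samplingProcess (δ : ℕ → ℝ) (X : Ω → E) (N : ℕ → Ω → E) (k : ℕ) (ω : Ω) :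
    compProcess δ X N k ω = samplingProcess δ (fun _ _ => X ω) N k ω := by
  induction k with
  | zero => rfl
  | succ k ih => simp [compProcess, samplingProcess, ih]

lemma samplingProcess_const (δ : ℕ → ℝ) (x : E) (N : ℕ → Ω → E) (k : ℕ) (ω : Ω) :
    samplingProcess δ (fun _ _ => x) N k ω = elapsed δ k • x + noiseWalk δ N k ω := by
  induction k with
  | zero => simp [samplingProcess, noiseWalk, elapsed]
  | succ k ih =>
    simp only [samplingProcess]
    rw [ih, noiseWalk_succ, elapsed_succ, add_smul]; abel

lemma compProcess_eq (δ : ℕ → ℝ) (X : Ω → E) (N : ℕ → Ω → E) (k : ℕ) (ω : Ω) :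
    compProcess δ X N k ω = elapsed δ k • X ω + noiseWalk δ N k ω := by
  rw [compProcess_eq_samplingProcess, samplingProcess_const]

/-- The sampling process is a functional of the noise sequence. -/
lemma samplingProcess_eval (δ : ℕ → ℝ) (f : ℕ → E → E) (N : ℕ → Ω → E) (k : ℕ) (ω : Ω) :
    samplingProcess δ f N k ω = samplingProcess δ f (fun k (ν : ℕ → E) => ν k) k
      (fun k => N k ω) := by
  induction k with
  | zero => rfl
  | succ k ih => simp [samplingProcess, ih]

variable {δ : ℕ → ℝ} {f : ℕ → E → E} {N : ℕ → Ω → E}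

lemma measurable_samplingProcess_of_le {m : MeasurableSpace Ω} {k : ℕ}
    (hf : ∀ i < k, Measurable (f (i + 1))) (hN : ∀ i ≤ k, Measurable[m] (N i)) {j : ℕ}
    (hj : j ≤ k) : Measurable[m] (samplingProcess δ f N j) := by
  induction j with
  | zero => exact measurable_const
  | succ j ih =>
    have h1 := ih (by omega)
    exact (h1.add (((hf j (by omega)).comp h1).const_smul _)).add
      ((hN (j + 1) hj).const_smul _)

lemma measurable_samplingProcess {k : ℕ} (hf : ∀ i < k, Measurable (f (i + 1)))
    (hN : ∀ i, Measurable (N i)) : Measurable (samplingProcess δ f N k) :=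
  measurable_samplingProcess_of_le hf (fun i _ => hN i) le_rfl

lemma measurable_noiseWalk (hN : ∀ i, Measurable (N i)) (k : ℕ) : Measurable (noiseWalk δ N k) :=
  measurable_samplingProcess (fun _ _ => measurable_const) hN

lemma measurable_compProcess {X : Ω → E} (hX : Measurable X) (hN : ∀ i, Measurable (N i)) (k : ℕ) :
    Measurable (compProcess δ X N k) := by
  have h : compProcess δ X N k = fun ω => elapsed δ k • X ω + noiseWalk δ N k ω :=
    funext fun ω => compProcess_eq δ X N k ω
  rw [h]
  exact (hX.const_smul _).add (measurable_noiseWalk hN k)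

variable {P : Measure Ω} [IsProbabilityMeasure P]

lemma IsGaussianNoise.measurable_seq (h : IsGaussianNoise P N) :
    Measurable fun ω k => N k ω := measurable_pi_iff.2 h.measurable

lemma IsGaussianNoise.map_seq (h : IsGaussianNoise P N) :
    P.map (fun ω k => N k ω) = Measure.infinitePi fun _ : ℕ => stdGaussian E := by
  rw [(iIndepFun_iff_map_fun_eq_infinitePi_map h.measurable).1 h.indep]
  simp_rw [h.law]

/-- The noise of the next step is independent of the path so far. -/
lemma IsGaussianNoise.lintegral_next (h : IsGaussianNoise P N) {k : ℕ}
    (hf : ∀ i < k, Measurable (f (i + 1))) {G : (ℕ → E) × E → ℝ≥0∞} (hG : Measurable G) :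
    ∫⁻ ω, G (fun i => samplingProcess δ f N (min i k) ω, N (k + 1) ω) ∂P =
      ∫⁻ ω, ∫⁻ v, G (fun i => samplingProcess δ f N (min i k) ω, v) ∂(stdGaussian E) ∂P := by
  set U : Ω → ℕ → E := fun ω i => samplingProcess δ f N (min i k) ω with hU
  have hUm : Measurable U := measurable_pi_iff.2 fun i => measurable_samplingProcess
    (fun j hj => hf j (hj.trans_le (min_le_right _ _))) h.measurable
  have hind : IndepFun U (N (k + 1)) P := by
    have h1 := indep_iSup_of_disjoint (fun i => (h.measurable i).comap_le) h.indep
      (S := Set.Iic k) (T := {k + 1}) (by simp)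
    have h2 : MeasurableSpace.comap U inferInstance ≤
        ⨆ i ∈ Set.Iic k, MeasurableSpace.comap (N i) inferInstance := by
      rw [← measurable_iff_comap_le]
      refine @measurable_pi_lambda _ _ _ (_) _ _ fun i => ?_
      refine measurable_samplingProcess_of_le hf (fun i hi => ?_) (min_le_right i k)
      rw [measurable_iff_comap_le]
      exact le_iSup₂ (f := fun (i : ℕ) (_ : i ∈ Set.Iic k) =>
        MeasurableSpace.comap (N i) inferInstance) i hi
    refine indep_of_indep_of_le_left (indep_of_indep_of_le_right h1 ?_) h2
    exact le_iSup₂ (f := fun (i : ℕ) (_ : i ∈ ({k + 1} : Set ℕ)) =>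
        MeasurableSpace.comap (N i) inferInstance) (k + 1) rfl
  have hmap := (indepFun_iff_map_prod_eq_prod_map_map hUm.aemeasurable
    (h.measurable (k + 1)).aemeasurable).1 hind
  rw [h.law] at hmap
  calc ∫⁻ ω, G (U ω, N (k + 1) ω) ∂P = ∫⁻ p, G p ∂(P.map fun ω => (U ω, N (k + 1) ω)) :=
        (lintegral_map hG (hUm.prodMk (h.measurable _))).symm
    _ = _ := by
        rw [hmap, lintegral_prod _ hG.aemeasurable, lintegral_map (hG.lintegral_prod_right') hUm]

lemma IsGaussianNoise.lintegral_noiseWalk_next (h : IsGaussianNoise P N) (k : ℕ)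
    {G : (ℕ → E) × E → ℝ≥0∞} (hG : Measurable G) :
    ∫⁻ ω, G (fun i => noiseWalk δ N (min i k) ω, N (k + 1) ω) ∂P =
      ∫⁻ ω, ∫⁻ v, G (fun i => noiseWalk δ N (min i k) ω, v) ∂(stdGaussian E) ∂P :=
  h.lintegral_next (f := fun _ _ => 0) (fun _ _ => measurable_const) hG

lemma IsGaussianNoise.map_noiseWalk (h : IsGaussianNoise P N) (hδ : ∀ k, 0 ≤ δ k) (k : ℕ) :
    P.map (noiseWalk δ N k) =
      (stdGaussian E).map (fun v => Real.sqrt (elapsed δ k) • v) := by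
  induction k with
  | zero =>
    have : noiseWalk δ N 0 = fun _ => 0 := rfl
    simp [this, elapsed_zero]
  | succ k ih =>
    refine Measure.ext_of_lintegral _ fun F hF => ?_
    have hW := measurable_noiseWalk (δ := δ) h.measurable
    have h1 := h.lintegral_noiseWalk_next (δ := δ) k
      (G := fun q => F (q.1 k + Real.sqrt (δ (k + 1)) • q.2)) (by fun_prop)
    simp only [min_self] at h1
    have hF' : Measurable fun w : E =>
        ∫⁻ v, F (w + Real.sqrt (δ (k + 1)) • v) ∂(stdGaussian E) :=
      (by fun_prop : Measurable fun q : E × E =>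
        F (q.1 + Real.sqrt (δ (k + 1)) • q.2)).lintegral_prod_right
    rw [lintegral_map hF (hW _), elapsed_succ,
      ← map_add_smul_stdGaussian (elapsed_nonneg hδ k) (hδ _), lintegral_map hF (by fun_prop),
      lintegral_prod _ (by fun_prop)]
    simp_rw [noiseWalk_succ]
    refine h1.trans ?_
    refine (lintegral_map (f := fun w : E => ∫⁻ v, F (w + Real.sqrt (δ (k + 1)) • v)
      ∂(stdGaussian E)) hF' (hW k)).symm.trans ?_
    rw [ih, lintegral_map hF' (by fun_prop)]

end Noise

section Girsanov

variable {E : Type*} [NormedAddCommGroup E] [InnerProductSpace ℝ E] [FiniteDimensional ℝ E]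
  [MeasurableSpace E] [BorelSpace E] {Ω : Type*} [MeasurableSpace Ω]
  {δ : ℕ → ℝ} {f : ℕ → E → E} {N : ℕ → Ω → E} {P : Measure Ω} [IsProbabilityMeasure P]

/-- The likelihood of the first `k` steps of the path `p` under the drift `f`, relative to the
driftless process. -/
noncomputable def pathLik (δ : ℕ → ℝ) (f : ℕ → E → E) (p : ℕ → E) (k : ℕ) : ℝ :=
  ∏ i ∈ Finset.range k, tilt (δ (i + 1)) (f (i + 1) (p i)) (p (i + 1) - p i)

lemma pathLik_pos (δ : ℕ → ℝ) (f : ℕ → E → E) (p : ℕ → E) (k : ℕ) : 0 < pathLik δ f p k :=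
  Finset.prod_pos fun _ _ => tilt_pos _ _ _

lemma pathLik_succ (δ : ℕ → ℝ) (f : ℕ → E → E) (p : ℕ → E) (k : ℕ) :
    pathLik δ f p (k + 1) =
      pathLik δ f p k * tilt (δ (k + 1)) (f (k + 1) (p k)) (p (k + 1) - p k) :=
  Finset.prod_range_succ _ _

lemma pathLik_congr {p q : ℕ → E} {k : ℕ} (h : ∀ i ≤ k, p i = q i) :
    pathLik δ f p k = pathLik δ f q k := by
  refine Finset.prod_congr rfl fun i hi => ?_
  have := Finset.mem_range.1 hi
  rw [h i (by omega), h (i + 1) (by omega)]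

lemma pathLik_const (x : E) (p : ℕ → E) (k : ℕ) :
    pathLik δ (fun _ _ => x) p k = tilt (elapsed δ k) x (p k - p 0) := by
  induction k with
  | zero => simp [pathLik, elapsed]
  | succ k ih =>
    rw [pathLik_succ, ih, elapsed_succ, ← tilt_add]
    congr 1; abel

lemma measurable_pathLik {k : ℕ} (hf : ∀ i < k, Measurable (f (i + 1))) :
    Measurable fun p : ℕ → E => pathLik δ f p k := by
  unfold pathLik
  refine Finset.measurable_fun_prod _ fun i hi => ?_
  have h1 : Measurable fun p : ℕ → E => f (i + 1) (p i) :=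
    (hf i (Finset.mem_range.1 hi)).comp (measurable_pi_apply i)
  have h2 : Measurable fun p : ℕ → E => p (i + 1) - p i := by fun_prop
  unfold tilt
  exact ((h1.inner h2).sub ((h1.norm.pow_const 2).const_mul _)).exp

/-- **Girsanov's formula** in discrete time: the law of the sampling process has density `pathLik`
with respect to that of the driftless process. Each step is an instance of the Cameron–Martin
formula. -/
theorem IsGaussianNoise.lintegral_sampling_path (h : IsGaussianNoise P N) (hδ : ∀ k, 0 ≤ δ k)
    {k : ℕ} (hf : ∀ i < k, Measurable (f (i + 1))) {F : (ℕ → E) → ℝ≥0∞} (hF : Measurable F) :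
    ∫⁻ ω, F (fun i => samplingProcess δ f N (min i k) ω) ∂P =
      ∫⁻ ω, ENNReal.ofReal (pathLik δ f (fun i => noiseWalk δ N (min i k) ω) k) *
        F (fun i => noiseWalk δ N (min i k) ω) ∂P := by
  induction k generalizing F with
  | zero =>
    refine lintegral_congr fun ω => ?_
    simp [pathLik, samplingProcess, noiseWalk]
  | succ k ih =>
    have hf' : ∀ i < k, Measurable (f (i + 1)) := fun i hi => hf i (by omega)
    have hfk : Measurable (f (k + 1)) := hf k (by omega)
    set s := Real.sqrt (δ (k + 1)) with hs
    -- The path after one more step, as a function of the path so far and of the increment.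
    set append : (ℕ → E) → E → ℕ → E := fun q y i => if i ≤ k then q i else q k + y with happend
    have happendm : Measurable fun q : (ℕ → E) × E => append q.1 q.2 := by
      refine measurable_pi_iff.2 fun i => ?_
      by_cases hi : i ≤ k
      · simp only [happend, hi, if_true]; fun_prop
      · simp only [happend, hi, if_false]; fun_prop
    have hpath : ∀ (g : ℕ → E → E) (ω : Ω),
        (fun i => samplingProcess δ g N (min i (k + 1)) ω) =
          append (fun i => samplingProcess δ g N (min i k) ω)
            (δ (k + 1) • g (k + 1) (samplingProcess δ g N k ω) + s • N (k + 1) ω) := by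
      intro g ω
      ext1 i
      by_cases hi : i ≤ k
      · simp only [happend, hi, if_true]
        rw [min_eq_left hi, min_eq_left (by omega)]
      · simp only [happend, hi, if_false]
        rw [min_self, min_eq_right (by omega)]
        exact add_assoc _ _ _
    have hss : ∀ x v : E, δ (k + 1) • x + s • v = s • (s • x + v) := fun x v => by
      rw [smul_add, smul_smul, hs, Real.mul_self_sqrt (hδ _)]
    set G : (ℕ → E) × E → ℝ≥0∞ := fun q => F (append q.1 (s • q.2)) with hG
    have hGm : Measurable G :=
      hF.comp (happendm.comp (measurable_fst.prodMk (measurable_snd.const_smul s)))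
    have hGm2 : Measurable fun q : (ℕ → E) × E =>
        G (q.1, s • f (k + 1) (q.1 k) + q.2) := by
      refine hGm.comp (measurable_fst.prodMk ?_)
      exact ((hfk.comp (by fun_prop)).const_smul s).add measurable_snd
    have hwm : Measurable fun q : (ℕ → E) × E =>
        ENNReal.ofReal (tilt (δ (k + 1)) (f (k + 1) (q.1 k)) (s • q.2)) := by
      have h1 : Measurable fun q : (ℕ → E) × E => f (k + 1) (q.1 k) := hfk.comp (by fun_prop)
      have h2 : Measurable fun q : (ℕ → E) × E => s • q.2 := by fun_prop
      unfold tilt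
      exact ((h1.inner h2).sub ((h1.norm.pow_const 2).const_mul _)).exp.ennreal_ofReal
    have hlm : Measurable fun q : (ℕ → E) × E => ENNReal.ofReal (pathLik δ f q.1 k) :=
      ((measurable_pathLik hf').comp measurable_fst).ennreal_ofReal
    obtain ⟨ψ, hψ⟩ : ∃ ψ : (ℕ → E) × E → ℝ≥0∞, ψ = fun q =>
      ENNReal.ofReal (tilt (δ (k + 1)) (f (k + 1) (q.1 k)) (s • q.2)) * G q := ⟨_, rfl⟩
    have hψm : Measurable ψ := by rw [hψ]; exact hwm.mul hGm
    obtain ⟨χ, hχ⟩ : ∃ χ : (ℕ → E) × E → ℝ≥0∞, χ = fun q =>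
      ENNReal.ofReal (pathLik δ f q.1 k) * ψ q := ⟨_, rfl⟩
    have hχm : Measurable χ := by rw [hχ]; exact hlm.mul hψm
    -- Integrating out the last increment with the Cameron–Martin formula removes the last drift.
    have hCM : ∀ q : ℕ → E, ∫⁻ v, G (q, s • f (k + 1) (q k) + v) ∂(stdGaussian E) =
        ∫⁻ v, ψ (q, v) ∂(stdGaussian E) := fun q => by
      rw [lintegral_add_stdGaussian (F := fun v => G (q, v))
        (hGm.comp (measurable_const.prodMk measurable_id))]
      refine lintegral_congr fun v => ?_
      rw [hψ, hs, ← tilt_smul_eq _ (hδ _)]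
    calc ∫⁻ ω, F (fun i => samplingProcess δ f N (min i (k + 1)) ω) ∂P
        = ∫⁻ ω, (fun q : (ℕ → E) × E => G (q.1, s • f (k + 1) (q.1 k) + q.2))
            (fun i => samplingProcess δ f N (min i k) ω, N (k + 1) ω) ∂P := by
          refine lintegral_congr fun ω => ?_
          rw [hpath f ω, hss]
          simp [hG]
      _ = ∫⁻ ω, (fun q => ∫⁻ v, ψ (q, v) ∂(stdGaussian E))
            (fun i => samplingProcess δ f N (min i k) ω) ∂P := by
          rw [h.lintegral_next hf' hGm2]
          exact lintegral_congr fun ω => hCM _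
      _ = ∫⁻ ω, ENNReal.ofReal (pathLik δ f (fun i => noiseWalk δ N (min i k) ω) k) *
            ∫⁻ v, ψ (fun i => noiseWalk δ N (min i k) ω, v) ∂(stdGaussian E) ∂P :=
          ih hf' hψm.lintegral_prod_right'
      _ = ∫⁻ ω, ∫⁻ v, χ (fun i => noiseWalk δ N (min i k) ω, v) ∂(stdGaussian E) ∂P := by
          refine lintegral_congr fun ω => ?_
          rw [hχ]
          exact (lintegral_const_mul _ (hψm.comp (measurable_const.prodMk measurable_id))).symm
      _ = ∫⁻ ω, χ (fun i => noiseWalk δ N (min i k) ω, N (k + 1) ω) ∂P :=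
          (h.lintegral_noiseWalk_next k hχm).symm
      _ = _ := by
          refine lintegral_congr fun ω => ?_
          have h1 := hpath (fun _ _ => 0) ω
          rw [smul_zero, zero_add] at h1
          have h2 : (fun i => noiseWalk δ N (min i (k + 1)) ω) =
              append (fun i => noiseWalk δ N (min i k) ω) (s • N (k + 1) ω) := h1
          have h3 : pathLik δ f (fun i => noiseWalk δ N (min i (k + 1)) ω) (k + 1) =
              pathLik δ f (fun i => noiseWalk δ N (min i k) ω) k *
                tilt (δ (k + 1)) (f (k + 1) (noiseWalk δ N (min k k) ω)) (s • N (k + 1) ω) := by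
            rw [pathLik_succ, pathLik_congr (q := fun i => noiseWalk δ N (min i k) ω)]
            · rw [min_self, min_self, min_eq_left (by omega : k ≤ k + 1), noiseWalk_succ,
                add_sub_cancel_left]
            · intro i hi
              rw [min_eq_left hi, min_eq_left (by omega)]
          rw [h3, h2, ENNReal.ofReal_mul (pathLik_pos _ _ _ _).le, mul_assoc, hχ, hψ]

end Girsanov

/-! ### The comparison process and the path laws -/

section Comparison

variable {E : Type*} [NormedAddCommGroup E] [InnerProductSpace ℝ E] [FiniteDimensional ℝ E]
  [MeasurableSpace E] [BorelSpace E] {Ω : Type*} [MeasurableSpace Ω]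
  {δ : ℕ → ℝ} {N : ℕ → Ω → E} {P : Measure Ω} [IsProbabilityMeasure P]
  {μ : Measure E} [IsProbabilityMeasure μ] {X : Ω → E}

/-- A signal `X` of law `μ`, independent of the Gaussian noise sequence `N`. -/
structure IsSignalNoise (P : Measure Ω) (μ : Measure E) (X : Ω → E) (N : ℕ → Ω → E) : Prop where
  noise : IsGaussianNoise P N
  measurable : Measurable X
  law : P.map X = μ
  indep : IndepFun X (fun ω k => N k ω) P

lemma IsSignalNoise.lintegral_eq (h : IsSignalNoise P μ X N) {G : E × (ℕ → E) → ℝ≥0∞}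
    (hG : Measurable G) :
    ∫⁻ ω, G (X ω, fun k => N k ω) ∂P = ∫⁻ x, ∫⁻ ω, G (x, fun k => N k ω) ∂P ∂μ := by
  have hm := h.noise.measurable_seq
  have hmap := (indepFun_iff_map_prod_eq_prod_map_map h.measurable.aemeasurable
    hm.aemeasurable).1 h.indep
  rw [h.law] at hmap
  rw [← lintegral_map hG (h.measurable.prodMk hm), hmap, lintegral_prod _ hG.aemeasurable]
  refine lintegral_congr fun x => ?_
  exact lintegral_map (hG.comp (measurable_const.prodMk measurable_id)) hm

lemma noiseWalk_eval (δ : ℕ → ℝ) (N : ℕ → Ω → E) (k : ℕ) (ω : Ω) :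
    noiseWalk δ N k ω = noiseWalk δ (fun k (ν : ℕ → E) => ν k) k (fun k => N k ω) :=
  samplingProcess_eval _ _ _ _ _

lemma measurable_noiseWalk_eval (k : ℕ) :
    Measurable fun ν : ℕ → E => noiseWalk δ (fun k (ν : ℕ → E) => ν k) k ν :=
  measurable_noiseWalk (fun i => measurable_pi_apply i) k

/-- Conditioning on the signal turns functionals of the comparison process into functionals of a
noise walk of constant drift. -/
lemma IsSignalNoise.lintegral_comp_functional (h : IsSignalNoise P μ X N) (δ : ℕ → ℝ)
    {G : E × (ℕ → E) × (ℕ → E) → ℝ≥0∞} (hG : Measurable G) :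
    ∫⁻ ω, G (X ω, fun k => N k ω, fun k => compProcess δ X N k ω) ∂P =
      ∫⁻ x, ∫⁻ ω, G (x, fun k => N k ω, fun k => elapsed δ k • x + noiseWalk δ N k ω) ∂P ∂μ := by
  have hGm : Measurable fun p : E × (ℕ → E) => G (p.1, p.2,
      fun k => elapsed δ k • p.1 + noiseWalk δ (fun k (ν : ℕ → E) => ν k) k p.2) := by
    refine hG.comp (measurable_fst.prodMk (measurable_snd.prodMk ?_))
    exact measurable_pi_iff.2 fun k => (measurable_fst.const_smul _).add
      ((measurable_noiseWalk_eval k).comp measurable_snd)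
  have := h.lintegral_eq hGm
  simp only [← noiseWalk_eval] at this
  rw [← this]
  simp_rw [compProcess_eq]

/-- At each step the comparison process is an observation of the signal at the elapsed time. -/
theorem IsSignalNoise.isObservation (h : IsSignalNoise P μ X N) (hδ : ∀ k, 0 ≤ δ k) (k : ℕ) :
    IsObservation P μ (elapsed δ k) X (compProcess δ X N k) := by
  have hYm := measurable_compProcess (δ := δ) h.measurable h.noise.measurable k
  refine Measure.ext_of_lintegral _ fun F hF => ?_
  have h1 := h.lintegral_comp_functional δ (G := fun q => F (q.1, q.2.2 k)) (by fun_prop)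
  rw [lintegral_map hF (h.measurable.prodMk hYm), lintegral_map hF (by fun_prop),
    lintegral_prod _ (by fun_prop)]
  refine h1.trans (lintegral_congr fun x => ?_)
  have h2 : Measurable fun w => F (x, elapsed δ k • x + w) := by fun_prop
  refine (lintegral_map (f := fun w => F (x, elapsed δ k • x + w)) h2
    (measurable_noiseWalk h.noise.measurable k)).symm.trans ?_
  rw [h.noise.map_noiseWalk hδ, lintegral_map h2 (by fun_prop)]
  refine lintegral_congr fun v => ?_
  dsimp only
  rw [smul_add, smul_smul, Real.mul_self_sqrt (elapsed_nonneg hδ k)]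

lemma IsSignalNoise.map_compProcess_next (h : IsSignalNoise P μ X N) (k : ℕ) :
    P.map (fun ω => (compProcess δ X N k ω, N (k + 1) ω)) =
      (P.map (compProcess δ X N k)).prod (stdGaussian E) := by
  have hYm := measurable_compProcess (δ := δ) h.measurable h.noise.measurable k
  refine Measure.ext_of_lintegral _ fun F hF => ?_
  rw [lintegral_map hF (hYm.prodMk (h.noise.measurable _)), lintegral_prod _ hF.aemeasurable,
    lintegral_map hF.lintegral_prod_right' hYm]
  refine (h.lintegral_comp_functional δ (G := fun q => F (q.2.2 k, q.2.1 (k + 1)))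
    (by fun_prop)).trans ?_
  have hF2 : Measurable fun q : E × (ℕ → E) × (ℕ → E) =>
      ∫⁻ v, F (q.2.2 k, v) ∂(stdGaussian E) :=
    hF.lintegral_prod_right'.comp (by fun_prop : Measurable fun q : E × (ℕ → E) × (ℕ → E) =>
      q.2.2 k)
  refine Eq.trans (lintegral_congr fun x => ?_) (h.lintegral_comp_functional δ hF2).symm
  have := h.noise.lintegral_noiseWalk_next (δ := δ) k
    (G := fun q => F (elapsed δ k • x + q.1 k, q.2)) (by fun_prop)
  simpa only [min_self] using this

/-- A step of the noise is uncorrelated with any function of the process so far. -/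
lemma IsSignalNoise.integral_inner_next (h : IsSignalNoise P μ X N) (k : ℕ) {g : E → E}
    (hg : Measurable g) (hg2 : MemLp (fun ω => g (compProcess δ X N k ω)) 2 P) :
    Integrable (fun ω => (inner ℝ (g (compProcess δ X N k ω)) (N (k + 1) ω) : ℝ)) P ∧
      ∫ ω, (inner ℝ (g (compProcess δ X N k ω)) (N (k + 1) ω) : ℝ) ∂P = 0 := by
  have hYm := measurable_compProcess (δ := δ) h.measurable h.noise.measurable k
  have hN2 : MemLp (N (k + 1)) 2 P := by
    have h1 : MemLp (fun v : E => v) 2 (P.map (N (k + 1))) := by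
      rw [h.noise.law]; exact IsGaussian.memLp_two_id
    exact (memLp_map_measure_iff (by fun_prop) (h.noise.measurable _).aemeasurable).1 h1
  have hi := integrable_inner_of_memLp hg2 hN2
  refine ⟨hi, ?_⟩
  have hm : Measurable fun q : E × E => (inner ℝ (g q.1) q.2 : ℝ) := by fun_prop
  have hpm := hYm.prodMk (h.noise.measurable (k + 1))
  have hi2 : Integrable (fun q : E × E => (inner ℝ (g q.1) q.2 : ℝ))
      (P.map fun ω => (compProcess δ X N k ω, N (k + 1) ω)) :=
    (integrable_map_measure hm.aestronglyMeasurable hpm.aemeasurable).2 hi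
  have h1 : ∫ ω, (inner ℝ (g (compProcess δ X N k ω)) (N (k + 1) ω) : ℝ) ∂P =
      ∫ q, (inner ℝ (g q.1) q.2 : ℝ)
        ∂(P.map fun ω => (compProcess δ X N k ω, N (k + 1) ω)) :=
    (integral_map hpm.aemeasurable hm.aestronglyMeasurable).symm
  rw [h.map_compProcess_next] at h1 hi2
  have hp : IsProbabilityMeasure (P.map (compProcess δ X N k)) :=
    Measure.isProbabilityMeasure_map hYm.aemeasurable
  rw [h1, integral_prod _ hi2]
  have : ∀ x : E, ∫ v, (inner ℝ x v : ℝ) ∂(stdGaussian E) = 0 := fun x =>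
    integral_strongDual_stdGaussian (innerSL ℝ x)
  simp [this]

/-- The law of the comparison process has density `evidence` with respect to the driftless
process: the constant-drift likelihoods are averaged over the signal. -/
lemma IsSignalNoise.lintegral_comp_path (h : IsSignalNoise P μ X N) (hδ : ∀ k, 0 ≤ δ k)
    {n : ℕ} (hn : 0 < elapsed δ n) {F : (ℕ → E) → ℝ≥0∞} (hF : Measurable F) :
    ∫⁻ ω, F (fun i => compProcess δ X N (min i n) ω) ∂P =
      ∫⁻ ω, ENNReal.ofReal (evidence μ (elapsed δ n) (noiseWalk δ N n ω)) *
        F (fun i => noiseWalk δ N (min i n) ω) ∂P := by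
  have hW := measurable_noiseWalk (δ := δ) h.noise.measurable
  have hFW : Measurable fun ω => F (fun i => noiseWalk δ N (min i n) ω) :=
    hF.comp (measurable_pi_iff.2 fun i => hW _)
  have h1 := h.lintegral_comp_functional δ (G := fun q => F (fun i => q.2.2 (min i n)))
    (hF.comp (by fun_prop))
  refine h1.trans ?_
  have h2 : ∀ x : E, ∫⁻ ω, F (fun i => elapsed δ (min i n) • x + noiseWalk δ N (min i n) ω) ∂P =
      ∫⁻ ω, ENNReal.ofReal (tilt (elapsed δ n) x (noiseWalk δ N n ω)) *
        F (fun i => noiseWalk δ N (min i n) ω) ∂P := fun x => by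
    have := h.noise.lintegral_sampling_path (f := fun _ _ => x) (k := n) hδ
      (fun _ _ => measurable_const) hF
    simp only [samplingProcess_const, pathLik_const, min_self, Nat.zero_min] at this
    rw [this]
    simp [noiseWalk, samplingProcess]
  simp_rw [h2]
  have hm : Measurable fun q : E × Ω =>
      ENNReal.ofReal (tilt (elapsed δ n) q.1 (noiseWalk δ N n q.2)) *
        F (fun i => noiseWalk δ N (min i n) q.2) := by
    refine Measurable.mul ?_ (hFW.comp measurable_snd)
    exact ((continuous_tilt (elapsed δ n)).measurable.comp
      (measurable_fst.prodMk ((hW n).comp measurable_snd))).ennreal_ofReal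
  rw [lintegral_lintegral_swap hm.aemeasurable]
  refine lintegral_congr fun ω => ?_
  rw [lintegral_mul_const _ (measurable_tilt_left _ _).ennreal_ofReal,
    lintegral_tilt_eq (integrable_tilt_of_pos hn _)]

end Comparison

section PathLaw

variable {E : Type*} [NormedAddCommGroup E] [InnerProductSpace ℝ E] [FiniteDimensional ℝ E]
  [MeasurableSpace E] [BorelSpace E] {Ω : Type*} [MeasurableSpace Ω]
  {δ : ℕ → ℝ} {f : ℕ → E → E} {N : ℕ → Ω → E} {P : Measure Ω} [IsProbabilityMeasure P]

/-- The path with the positions `q` at the times `1, …, n`, which starts at `0`. -/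
def extendPath (n : ℕ) (q : Fin n → E) (i : ℕ) : E :=
  if h : 0 < i ∧ i ≤ n then q ⟨i - 1, by omega⟩ else 0

lemma extendPath_eq {n : ℕ} {p : ℕ → E} (h0 : p 0 = 0) {i : ℕ} (hi : i ≤ n) :
    extendPath n (fun j : Fin n => p (j.val + 1)) i = p i := by
  rcases Nat.eq_zero_or_pos i with rfl | h
  · simp [extendPath, h0]
  · rw [extendPath, dif_pos ⟨h, hi⟩]
    dsimp only
    rw [Nat.sub_add_cancel h]

lemma measurable_extendPath (n : ℕ) : Measurable fun q : Fin n → E => extendPath n q := by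
  refine measurable_pi_iff.2 fun i => ?_
  unfold extendPath
  split_ifs <;> fun_prop

lemma lintegral_pathLaw {V : ℕ → Ω → E} {n : ℕ} (hV : ∀ k ≤ n, Measurable (V k))
    {F : (Fin n → E) → ℝ≥0∞} (hF : Measurable F) :
    ∫⁻ q, F q ∂(pathLaw P V n) = ∫⁻ ω, F (fun i => V (i.val + 1) ω) ∂P := by
  rw [pathLaw, lintegral_map hF (measurable_pi_iff.2 fun i => hV _ (by omega))]

lemma pathLaw_eq_withDensity {Ω' : Type*} [MeasurableSpace Ω'] {P' : Measure Ω'}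
    [IsProbabilityMeasure P']
    {V : ℕ → Ω → E} {W : ℕ → Ω' → E} {n : ℕ} (hV : ∀ k ≤ n, Measurable (V k))
    (hW : ∀ k ≤ n, Measurable (W k)) {a : (Fin n → E) → ℝ} (ha : Measurable a)
    (h : ∀ F : (ℕ → E) → ℝ≥0∞, Measurable F → ∫⁻ ω, F (fun i => V (min i n) ω) ∂P =
      ∫⁻ ω, ENNReal.ofReal (a (fun i : Fin n => W (i.val + 1) ω)) *
        F (fun i => W (min i n) ω) ∂P') :
    pathLaw P V n = (pathLaw P' W n).withDensity fun q => ENNReal.ofReal (a q) := by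
  refine Measure.ext_of_lintegral _ fun F hF => ?_
  rw [lintegral_withDensity_eq_lintegral_mul _ ha.ennreal_ofReal hF, lintegral_pathLaw hV hF,
    lintegral_pathLaw hW (ha.ennreal_ofReal.mul hF)]
  have := h (fun p => F (fun i : Fin n => p (i.val + 1))) (hF.comp (by fun_prop))
  have hmin : ∀ i : Fin n, min (i.val + 1) n = i.val + 1 := fun i => min_eq_left (by omega)
  simp only [hmin] at this
  exact this

/-- The law of the driftless path does not depend on the probability space that carries it. -/
lemma IsGaussianNoise.pathLaw_noiseWalk (h : IsGaussianNoise P N) (δ : ℕ → ℝ) (n : ℕ) :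
    pathLaw P (noiseWalk δ N) n = pathLaw (Measure.infinitePi fun _ : ℕ => stdGaussian E)
      (noiseWalk δ fun k (ν : ℕ → E) => ν k) n := by
  have hm : Measurable fun (ν : ℕ → E) (i : Fin n) =>
      noiseWalk δ (fun k (ν : ℕ → E) => ν k) (i.val + 1) ν :=
    measurable_pi_iff.2 fun i => measurable_noiseWalk_eval _
  rw [← h.map_seq, pathLaw, pathLaw, Measure.map_map hm h.measurable_seq]
  congr 1
  funext ω i
  exact noiseWalk_eval _ _ _ _

lemma measurable_pathLik_extendPath {n : ℕ} (hf : ∀ i < n, Measurable (f (i + 1))) :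
    Measurable fun q : Fin n → E => pathLik δ f (extendPath n q) n :=
  (measurable_pathLik hf).comp (measurable_extendPath n)

lemma IsGaussianNoise.pathLaw_sampling_eq (h : IsGaussianNoise P N) (hδ : ∀ k, 0 ≤ δ k)
    {n : ℕ} (hf : ∀ i < n, Measurable (f (i + 1))) :
    pathLaw P (samplingProcess δ f N) n = (pathLaw P (noiseWalk δ N) n).withDensity
      fun q => ENNReal.ofReal (pathLik δ f (extendPath n q) n) := by
  refine pathLaw_eq_withDensity
    (fun k hk => measurable_samplingProcess (fun i hi => hf i (by omega)) h.measurable)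
    (fun k _ => measurable_noiseWalk h.measurable k)
    (measurable_pathLik_extendPath hf) fun F hF => ?_
  rw [h.lintegral_sampling_path hδ hf hF]
  refine lintegral_congr fun ω => ?_
  congr 2
  refine pathLik_congr fun i hi => ?_
  rw [extendPath_eq (p := fun i => noiseWalk δ N i ω) rfl hi, min_eq_left hi]

lemma IsSignalNoise.pathLaw_comp_eq {μ : Measure E} [IsProbabilityMeasure μ] {X : Ω → E}
    (h : IsSignalNoise P μ X N) (hδ : ∀ k, 0 ≤ δ k) {n : ℕ} (hn : 0 < elapsed δ n) :
    pathLaw P (compProcess δ X N) n = (pathLaw P (noiseWalk δ N) n).withDensity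
      fun q => ENNReal.ofReal (evidence μ (elapsed δ n) (extendPath n q n)) := by
  refine pathLaw_eq_withDensity
    (fun k _ => measurable_compProcess h.measurable h.noise.measurable k)
    (fun k _ => measurable_noiseWalk h.noise.measurable k)
    ((measurable_evidence μ _).comp ((measurable_pi_apply n).comp (measurable_extendPath n)))
    fun F hF => ?_
  rw [h.lintegral_comp_path hδ hn hF]
  refine lintegral_congr fun ω => ?_
  rw [extendPath_eq (p := fun i => noiseWalk δ N i ω) rfl le_rfl]

end PathLaw

/-! ### The divergence of the path laws, and Riemann sums -/

section Divergence

variable {E : Type*} [NormedAddCommGroup E] [InnerProductSpace ℝ E] [FiniteDimensional ℝ E]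
  [MeasurableSpace E] [BorelSpace E] {Ω : Type*} [MeasurableSpace Ω]
  {δ : ℕ → ℝ} {f : ℕ → E → E} {N : ℕ → Ω → E} {P : Measure Ω} [IsProbabilityMeasure P]
  {μ : Measure E} [IsProbabilityMeasure μ] {X : Ω → E}

/-- The mean of the log-likelihood of one step under the conditional mean drift: the drift is
correlated with the signal and not with the noise. -/
lemma IsSignalNoise.integral_log_step (h : IsSignalNoise P μ X N) (hμ : MemLp (fun x => x) 2 μ)
    (hδ : ∀ k, 0 ≤ δ k) (k : ℕ)
    (hfk : (fun ω => f (k + 1) (compProcess δ X N k ω)) =ᵐ[P]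
      P[X | MeasurableSpace.comap (compProcess δ X N k) inferInstance]) :
    Integrable (fun ω => Real.log (tilt (δ (k + 1)) (f (k + 1) (compProcess δ X N k ω))
      (compProcess δ X N (k + 1) ω - compProcess δ X N k ω))) P ∧
    ∫ ω, Real.log (tilt (δ (k + 1)) (f (k + 1) (compProcess δ X N k ω))
      (compProcess δ X N (k + 1) ω - compProcess δ X N k ω)) ∂P =
      δ (k + 1) / 2 * estEnergy μ (elapsed δ k) := by
  have ht := elapsed_nonneg hδ k
  have hYm := measurable_compProcess (δ := δ) h.measurable h.noise.measurable k
  have hobs := h.isObservation hδ k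
  have hm2 := hobs.memLp_posteriorMean h.measurable hYm ht hμ
  have i1 := integrable_inner_of_memLp (hobs.memLp h.measurable hYm hμ) hm2
  have i2 : Integrable (fun ω => ‖posteriorMean μ (elapsed δ k) (compProcess δ X N k ω)‖ ^ 2) P :=
    (memLp_two_iff_integrable_sq_norm hm2.1).1 hm2
  obtain ⟨i3, e3⟩ := h.integral_inner_next k (measurable_posteriorMean (elapsed δ k)) hm2
  have key : (fun ω => Real.log (tilt (δ (k + 1)) (f (k + 1) (compProcess δ X N k ω))
      (compProcess δ X N (k + 1) ω - compProcess δ X N k ω))) =ᵐ[P] fun ω =>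
      (δ (k + 1) * inner ℝ (X ω) (posteriorMean μ (elapsed δ k) (compProcess δ X N k ω)) +
      Real.sqrt (δ (k + 1)) *
        inner ℝ (posteriorMean μ (elapsed δ k) (compProcess δ X N k ω)) (N (k + 1) ω)) -
      δ (k + 1) / 2 * ‖posteriorMean μ (elapsed δ k) (compProcess δ X N k ω)‖ ^ 2 := by
    filter_upwards [hfk, hobs.condExp_eq h.measurable hYm ht hμ] with ω h1 h2
    have hstep : compProcess δ X N (k + 1) ω - compProcess δ X N k ω =
        δ (k + 1) • X ω + Real.sqrt (δ (k + 1)) • N (k + 1) ω := by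
      simp only [compProcess]; abel
    rw [h1, h2, hstep, tilt, Real.log_exp, inner_add_right, inner_smul_right, inner_smul_right,
      real_inner_comm (X ω)]
  have i4 : Integrable (fun ω =>
      δ (k + 1) * inner ℝ (X ω) (posteriorMean μ (elapsed δ k) (compProcess δ X N k ω)) +
      Real.sqrt (δ (k + 1)) *
        inner ℝ (posteriorMean μ (elapsed δ k) (compProcess δ X N k ω)) (N (k + 1) ω)) P :=
    (i1.const_mul (δ (k + 1))).add (i3.const_mul (Real.sqrt (δ (k + 1))))
  refine ⟨(i4.sub (i2.const_mul _)).congr key.symm, ?_⟩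
  rw [integral_congr_ae key, integral_sub i4 (i2.const_mul _),
    integral_add (i1.const_mul _) (i3.const_mul _), integral_const_mul, integral_const_mul,
    integral_const_mul, e3, hobs.integral_inner_posteriorMean h.measurable hYm ht hμ,
    hobs.integral_norm_posteriorMean_sq h.measurable hYm ht]
  ring

/-- The divergence between the two path laws: the mean log-likelihood ratio is the relative entropy
of the final observation minus the mean log-likelihoods of the steps. -/
theorem IsSignalNoise.klDiv_pathLaw (h : IsSignalNoise P μ X N) (hμ : MemLp (fun x => x) 2 μ)
    {Ω' : Type*} [MeasurableSpace Ω'] {P' : Measure Ω'} [IsProbabilityMeasure P']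
    {N' : ℕ → Ω' → E} (h' : IsGaussianNoise P' N') (hδ : ∀ k, 0 ≤ δ k) {n : ℕ}
    (hn : 0 < elapsed δ n) (hf : ∀ i < n, Measurable (f (i + 1)))
    (hfe : ∀ i < n, (fun ω => f (i + 1) (compProcess δ X N i ω)) =ᵐ[P]
      P[X | MeasurableSpace.comap (compProcess δ X N i) inferInstance]) :
    klDiv (pathLaw P (compProcess δ X N) n) (pathLaw P' (samplingProcess δ f N') n) ≠ ∞ ∧
      (klDiv (pathLaw P (compProcess δ X N) n) (pathLaw P' (samplingProcess δ f N') n)).toReal =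
        relEnt μ (elapsed δ n) -
          ∑ i ∈ Finset.range n, δ (i + 1) / 2 * estEnergy μ (elapsed δ i) := by
  have hY := measurable_compProcess (δ := δ) h.measurable h.noise.measurable
  set ν := pathLaw P (noiseWalk δ N) n with hν
  have e1 := h.pathLaw_comp_eq hδ hn
  have e2 : pathLaw P' (samplingProcess δ f N') n =
      ν.withDensity fun q => ENNReal.ofReal (pathLik δ f (extendPath n q) n) := by
    rw [h'.pathLaw_sampling_eq hδ hf, h'.pathLaw_noiseWalk, hν, h.noise.pathLaw_noiseWalk]
  have hYv : Measurable fun (ω : Ω) (i : Fin n) => compProcess δ X N (i.val + 1) ω :=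
    measurable_pi_iff.2 fun i => hY _
  have hνp : IsProbabilityMeasure ν := Measure.isProbabilityMeasure_map
    (measurable_pi_iff.2 fun i => measurable_noiseWalk h.noise.measurable _).aemeasurable
  have p1 : IsProbabilityMeasure (pathLaw P (compProcess δ X N) n) :=
    Measure.isProbabilityMeasure_map hYv.aemeasurable
  have p2 : IsProbabilityMeasure (pathLaw P' (samplingProcess δ f N') n) :=
    Measure.isProbabilityMeasure_map (measurable_pi_iff.2 fun i =>
      measurable_samplingProcess (fun j hj => hf j (by omega)) h'.measurable).aemeasurable
  have ham : Measurable fun q : Fin n → E => evidence μ (elapsed δ n) (extendPath n q n) :=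
    (measurable_evidence μ _).comp ((measurable_pi_apply n).comp (measurable_extendPath n))
  have hbm := measurable_pathLik_extendPath (δ := δ) hf
  have ha : ∀ q : Fin n → E, 0 < evidence μ (elapsed δ n) (extendPath n q n) := fun q =>
    evidence_pos (integrable_tilt_of_pos hn _)
  have hlm : Measurable fun q : Fin n → E =>
      Real.log (evidence μ (elapsed δ n) (extendPath n q n)) -
        Real.log (pathLik δ f (extendPath n q) n) := ham.log.sub hbm.log
  -- The log-likelihood ratio along the comparison process.
  have hratio : ∀ ω, Real.log (evidence μ (elapsed δ n)
        (extendPath n (fun i : Fin n => compProcess δ X N (i.val + 1) ω) n)) -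
      Real.log (pathLik δ f (extendPath n fun i : Fin n => compProcess δ X N (i.val + 1) ω) n) =
      Real.log (evidence μ (elapsed δ n) (compProcess δ X N n ω)) -
      ∑ i ∈ Finset.range n, Real.log (tilt (δ (i + 1)) (f (i + 1) (compProcess δ X N i ω))
        (compProcess δ X N (i + 1) ω - compProcess δ X N i ω)) := fun ω => by
    rw [extendPath_eq (p := fun i => compProcess δ X N i ω) rfl le_rfl,
      pathLik_congr (q := fun i => compProcess δ X N i ω) fun i hi =>
        extendPath_eq (p := fun i => compProcess δ X N i ω) rfl hi, pathLik,
      Real.log_prod fun i _ => (tilt_pos _ _ _).ne']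
  have hobs := h.isObservation hδ n
  have hle : StronglyMeasurable fun y : E => Real.log (evidence μ (elapsed δ n) y) :=
    (measurable_evidence μ _).log.stronglyMeasurable
  have j1 : Integrable (fun ω => Real.log (evidence μ (elapsed δ n) (compProcess δ X N n ω))) P :=
    (hobs.integrable_right_iff h.measurable (hY n) hn.le hle).2 (integrable_relEnt hμ hn.le)
  have j2 : ∫ ω, Real.log (evidence μ (elapsed δ n) (compProcess δ X N n ω)) ∂P =
      relEnt μ (elapsed δ n) :=
    hobs.integral_right_eq h.measurable (hY n) hn.le hle
  have j3 := fun i (hi : i ∈ Finset.range n) =>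
    h.integral_log_step hμ hδ i (hfe i (Finset.mem_range.1 hi))
  have j4 := integrable_finsetSum (Finset.range n) fun i hi => (j3 i hi).1
  have hint : Integrable (fun q : Fin n → E =>
      Real.log (evidence μ (elapsed δ n) (extendPath n q n)) -
        Real.log (pathLik δ f (extendPath n q) n)) (pathLaw P (compProcess δ X N) n) := by
    rw [pathLaw, integrable_map_measure hlm.aestronglyMeasurable hYv.aemeasurable]
    exact (j1.sub j4).congr (Filter.Eventually.of_forall fun ω => (hratio ω).symm)
  rw [e1] at p1 hint
  rw [e2] at p2
  have key := klDiv_withDensity ham hbm (Filter.Eventually.of_forall ha)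
    (Filter.Eventually.of_forall fun q => pathLik_pos _ _ _ _) hint
  rw [e2]
  rw [← e1] at key
  refine ⟨key.1, key.2.trans ?_⟩
  rw [pathLaw, integral_map hYv.aemeasurable hlm.aestronglyMeasurable]
  simp_rw [hratio]
  rw [integral_sub j1 j4, j2, integral_finsetSum _ fun i hi => (j3 i hi).1]
  congr 1
  exact Finset.sum_congr rfl fun i hi => (j3 i hi).2

end Divergence

section RiemannSums

variable {E : Type*} [NormedAddCommGroup E] [InnerProductSpace ℝ E] [FiniteDimensional ℝ E]
  [MeasurableSpace E] [BorelSpace E] {μ : Measure E} [IsProbabilityMeasure μ] {δ : ℕ → ℝ}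

/-- The relative entropy is at most half the right Riemann sum of the energy. -/
lemma relEnt_le_sum (hμ : MemLp (fun x => x) 2 μ) (hδ : ∀ k, 0 ≤ δ k) (n : ℕ) :
    relEnt μ (elapsed δ n) ≤
      ∑ i ∈ Finset.range n, δ (i + 1) / 2 * estEnergy μ (elapsed δ (i + 1)) := by
  induction n with
  | zero => simp [elapsed_zero, relEnt_zero]
  | succ n ih =>
    rw [Finset.sum_range_succ]
    have h1 := relEnt_sub_le hμ (elapsed_nonneg hδ n)
      (b := elapsed δ (n + 1)) (by rw [elapsed_succ]; linarith [hδ (n + 1)])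
    have h2 : elapsed δ (n + 1) - elapsed δ n = δ (n + 1) := by rw [elapsed_succ]; ring
    rw [h2] at h1
    linarith

/-- For steps growing by the factor `α`, the left Riemann sum is `α` times the right one, up to
boundary terms. -/
lemma sum_left_eq {α : ℝ} (hα : ∀ k, δ (k + 2) = α * δ (k + 1)) (Q : ℕ → ℝ) (n : ℕ) :
    ∑ i ∈ Finset.range (n + 1), δ (i + 1) / 2 * Q i =
      α * ∑ i ∈ Finset.range (n + 1), δ (i + 1) / 2 * Q (i + 1) + δ 1 / 2 * Q 0 -
        α * δ (n + 1) / 2 * Q (n + 1) := by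
  induction n with
  | zero => simp; ring
  | succ n ih =>
    rw [Finset.sum_range_succ, ih, Finset.sum_range_succ _ (n + 1), hα n]
    ring

end RiemannSums

section GeometricSteps

variable {α T : ℝ} {n : ℕ}

lemma pow_sub_one_ne_zero (hα : 0 < α) (hα1 : α ≠ 1) (hn : 1 ≤ n) : α ^ n - 1 ≠ 0 := by
  rw [sub_ne_zero]
  exact fun h => hα1 ((pow_eq_one_iff_of_nonneg hα.le (by omega)).1 h)

lemma geomTime_zero : geomTime α T n 0 = 0 := by simp [geomTime]

lemma geomTime_self (hα : 0 < α) (hn : 1 ≤ n) : geomTime α T n n = T := by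
  unfold geomTime
  split_ifs with h
  · have : (n : ℝ) ≠ 0 := by positivity
    field_simp
  · rw [div_self (pow_sub_one_ne_zero hα h hn), one_mul]

lemma elapsed_geomStep (k : ℕ) : elapsed (geomStep α T n) k = geomTime α T n k := by
  have := Finset.sum_range_sub (geomTime α T n) k
  simpa [elapsed, geomStep, geomTime_zero] using this

lemma geomStep_succ_succ (k : ℕ) :
    geomStep α T n (k + 2) = α * geomStep α T n (k + 1) := by
  simp only [geomStep, geomTime, Nat.add_sub_cancel, show k + 2 - 1 = k + 1 from rfl]
  split_ifs with h
  · rw [h]; push_cast; ring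
  · ring

lemma geomStep_one_of_eq : geomStep 1 T n 1 = T / n := by
  simp [geomStep, geomTime]; ring

lemma geomStep_one_of_ne (h : α ≠ 1) : geomStep α T n 1 = (α - 1) / (α ^ n - 1) * T := by
  simp [geomStep, geomTime, h]

lemma geomStep_one_nonneg (hα : 0 < α) (hT : 0 < T) : 0 ≤ geomStep α T n 1 := by
  rcases eq_or_ne α 1 with rfl | h
  · rw [geomStep_one_of_eq]; positivity
  rw [geomStep_one_of_ne h]
  refine mul_nonneg ?_ hT.le
  rcases lt_or_gt_of_ne h with h1 | h1
  · exact div_nonneg_of_nonpos (by linarith) (by linarith [pow_le_one₀ (n := n) hα.le h1.le])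
  · exact div_nonneg (by linarith) (by linarith [one_le_pow₀ (n := n) h1.le])

lemma geomStep_nonneg (hα : 0 < α) (hT : 0 < T) (k : ℕ) : 0 ≤ geomStep α T n k := by
  rcases k with _ | k
  · simp [geomStep]
  induction k with
  | zero => exact geomStep_one_nonneg hα hT
  | succ k ih => rw [geomStep_succ_succ]; exact mul_nonneg hα.le ih

lemma mul_geomStep_eq (k : ℕ) :
    α * geomStep α T n (k + 1) = geomStep α T n 1 + (α - 1) * geomTime α T n (k + 1) := by
  induction k with
  | zero => simp [geomStep, geomTime_zero]; ring
  | succ k ih =>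
    have h1 : geomTime α T n (k + 2) = geomTime α T n (k + 1) + geomStep α T n (k + 2) := by
      simp [geomStep]
    have h2 : geomStep α T n (k + 2) = α * geomStep α T n (k + 1) := geomStep_succ_succ k
    rw [h1]
    linear_combination h2 + ih

end GeometricSteps

end GaussSampling

theorem theorem2 {d : ℕ} (μ : Measure (EuclideanSpace ℝ (Fin d))) [IsProbabilityMeasure μ]
    (hμ : MemLp (fun x : EuclideanSpace ℝ (Fin d) => x) 2 μ)
    (n : ℕ) (hn : 1 ≤ n) (α T : ℝ) (hα : 0 < α) (hT : 0 < T)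
    -- the comparison process is driven by `X ∼ μ` and an independent i.i.d. Gaussian sequence `N`
    {Ω : Type*} [MeasurableSpace Ω] (P : Measure Ω) [IsProbabilityMeasure P]
    (X : Ω → EuclideanSpace ℝ (Fin d)) (hX : Measurable X) (hXlaw : P.map X = μ)
    (N : ℕ → Ω → EuclideanSpace ℝ (Fin d)) (hN : ∀ k, Measurable (N k))
    (hNlaw : ∀ k, P.map (N k) = stdGaussian (EuclideanSpace ℝ (Fin d)))
    (hNindep : iIndepFun N P) (hXN : IndepFun X (fun ω k => N k ω) P)
    -- the sampling process is driven by an i.i.d. Gaussian sequence `N'`, possibly elsewhere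
    {Ω' : Type*} [MeasurableSpace Ω'] (P' : Measure Ω') [IsProbabilityMeasure P']
    (N' : ℕ → Ω' → EuclideanSpace ℝ (Fin d)) (hN' : ∀ k, Measurable (N' k))
    (hNlaw' : ∀ k, P'.map (N' k) = stdGaussian (EuclideanSpace ℝ (Fin d)))
    (hNindep' : iIndepFun N' P')
    -- each `f k` is the conditional mean estimator of `X` given `Y_{k-1}`
    (f : ℕ → EuclideanSpace ℝ (Fin d) → EuclideanSpace ℝ (Fin d))
    (hf : ∀ k, 1 ≤ k → k ≤ n → GaussSampling.IsCondMeanEstimator P X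
      (GaussSampling.compProcess (GaussSampling.geomStep α T n) X N (k - 1)) (f k))
    -- the divergence between the two path laws
    (Δ : ℝ≥0∞)
    (hΔ : Δ = klDiv
      (GaussSampling.pathLaw P
        (GaussSampling.compProcess (GaussSampling.geomStep α T n) X N) n)
      (GaussSampling.pathLaw P'
        (GaussSampling.samplingProcess (GaussSampling.geomStep α T n) f N') n)) :
    GaussSampling.channelInfo μ T ≠ ∞ ∧ Δ ≠ ∞ ∧
    (α ≠ 1 → Δ.toReal ≤ (α - 1) *
      (T * (GaussSampling.mmse μ 0 - GaussSampling.mmse μ T) / (2 * (α ^ n - 1))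
        + (GaussSampling.channelInfo μ T).toReal - T * GaussSampling.mmse μ T / 2)) ∧
    (α = 1 → Δ.toReal ≤
      T * (GaussSampling.mmse μ 0 - GaussSampling.mmse μ T) / (2 * (n : ℝ))) := by
  have hsig : GaussSampling.IsSignalNoise P μ X N := ⟨⟨hN, hNlaw, hNindep⟩, hX, hXlaw, hXN⟩
  have hnoise : GaussSampling.IsGaussianNoise P' N' := ⟨hN', hNlaw', hNindep'⟩
  obtain ⟨m, rfl⟩ : ∃ m, n = m + 1 := ⟨n - 1, by omega⟩
  set δ := GaussSampling.geomStep α T (m + 1) with hδdef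
  have hδ : ∀ k, 0 ≤ δ k := GaussSampling.geomStep_nonneg hα hT
  have hTn : GaussSampling.elapsed δ (m + 1) = T := by
    rw [GaussSampling.elapsed_geomStep, GaussSampling.geomTime_self hα hn]
  obtain ⟨hI, hIeq⟩ := GaussSampling.channelInfo_eq hμ hT.le
  have hM0 := GaussSampling.mmse_eq hμ le_rfl
  have hMT := GaussSampling.mmse_eq hμ hT.le
  obtain ⟨hfin, hval⟩ := hsig.klDiv_pathLaw hμ hnoise hδ (n := m + 1) (by rw [hTn]; exact hT)
    (fun i hi => (hf (i + 1) (by omega) (by omega)).1)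
    (fun i hi => (hf (i + 1) (by omega) (by omega)).2)
  rw [← hΔ] at hfin hval
  have hleft := GaussSampling.sum_left_eq (δ := δ) GaussSampling.geomStep_succ_succ
    (fun i => GaussSampling.estEnergy μ (GaussSampling.elapsed δ i)) m
  have hright := mul_le_mul_of_nonneg_left (GaussSampling.relEnt_le_sum hμ hδ (m + 1)) hα.le
  have hlast : α * δ (m + 1) = δ 1 + (α - 1) * T := by
    rw [hδdef, GaussSampling.mul_geomStep_eq, GaussSampling.geomTime_self hα hn]
  rw [hlast, hTn, GaussSampling.elapsed_zero] at hleft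
  rw [hTn] at hval hright
  rw [hleft] at hval
  refine ⟨hI, hfin, fun h1 => ?_, fun h1 => ?_⟩
  · have hδ1 : δ 1 = (α - 1) / (α ^ (m + 1) - 1) * T := GaussSampling.geomStep_one_of_ne h1
    have hne := GaussSampling.pow_sub_one_ne_zero hα h1 hn
    rw [hIeq, hM0, hMT, hval]
    have e : (α - 1) * (T * (∫ x, ‖x‖ ^ 2 ∂μ - GaussSampling.estEnergy μ 0 -
        (∫ x, ‖x‖ ^ 2 ∂μ - GaussSampling.estEnergy μ T)) / (2 * (α ^ (m + 1) - 1)) +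
        (T / 2 * ∫ x, ‖x‖ ^ 2 ∂μ - GaussSampling.relEnt μ T) -
        T * (∫ x, ‖x‖ ^ 2 ∂μ - GaussSampling.estEnergy μ T) / 2) =
        δ 1 / 2 * (GaussSampling.estEnergy μ T - GaussSampling.estEnergy μ 0) +
        (α - 1) * (T / 2 * GaussSampling.estEnergy μ T - GaussSampling.relEnt μ T) := by
      rw [hδ1]; field_simp; ring
    rw [e]
    linarith
  · subst h1
    have hδ1 : δ 1 = T / ((m + 1 : ℕ) : ℝ) := GaussSampling.geomStep_one_of_eq
    rw [hM0, hMT, hval]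
    have e : T * (∫ x, ‖x‖ ^ 2 ∂μ - GaussSampling.estEnergy μ 0 -
        (∫ x, ‖x‖ ^ 2 ∂μ - GaussSampling.estEnergy μ T)) / (2 * ((m + 1 : ℕ) : ℝ)) =
        δ 1 / 2 * (GaussSampling.estEnergy μ T - GaussSampling.estEnergy μ 0) := by
      rw [hδ1]; field_simp; ring
    rw [e]
    linarith
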